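/- **Theorem (Spaltenstein's fibration).** Let $K$ be an algebraically closed field and $n\ge 1$. Let $M=(V_i,f_i\colon V_i\to V_{i+1})_{i\in\mathbb Z/n}$ be a finite-dimensional nilpotent representation over $K$ of the oriented cycle with $n$ vertices; nilpotent means that every composite $f_{i+n-1}\circ\cdots\circ f_{i}\colon V_i\to V_i$ is nilpotent. Let $r\ge 1$ and let $\mathbf d=(0=d^0\le d^1\le\cdots\le d^r=\underline{\dim}\,M)$ be a sequence of dimension vectors in $\mathbb N_0^{\mathbb Z/n}$ that is complete, i.e. $\sum_i d^{k+1}_i=\sum_i d^k_i+1$ for $0\le k<r$. Write $\mathrm{Fl}(M,\mathbf d)$ for the variety of flags $U=(U^0\subseteq\cdots\subseteq U^r=M)$ of subrepresentations with $\underline{\dim}\,U^k=d^k$, write $\mathrm{Gr}(M,d^1)$ for the variety of subrepresentations $L\subseteq M$ with $\underline{\dim}\,L=d^1$, and let $p\colon \mathrm{Fl}(M,\mathbf d)\to\mathrm{Gr}(M,d^1)$, $U\mapsto U^1$. (Both are regarded as classical varieties, via the Plücker embeddings of the Grassmannians of the $V_i$.) Let $\mathrm{sp}(U)=([M/U^k])_{1\le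 k\le r}$ be the tuple of isomorphism classes of the quotient representations. Let $s_i=\dim \mathrm{soc}(M)_i$ and, for each $i$, let $0=W_i^0\subset W_i^1\subset\cdots\subset W_i^{s_i}=\mathrm{soc}(M)_i$ be a complete flag such that each of the subspaces $(\mathrm{soc}(M)\cap\mathrm{rad}^m(M))_i$, $m\ge 0$, occurs among the $W_i^l$. For $w=(w_{i,l})_{i\in\mathbb Z/n,\,0\le l\le s_i}$ with $w_{i,l}\in\mathbb N_0$ put $$\mathrm{Gr}(M,d^1)_w=\{L\in\mathrm{Gr}(M,d^1)\mid \dim (L_i\cap W_i^l)=w_{i,l}\text{ for all } i,l\}.$$ Let $U_0\in\mathrm{Gr}(M,d^1)_w$ be arbitrary, and put $N=M/U_0$ and $\mathbf e=(d^1-d^1,d^2-d^1,\ldots,d^r-d^1)$. Then there is an isomorphism of algebraic varieties $$f\colon p^{-1}\bigl(\mathrm{Gr}(M,d^1)_w\bigr)\longrightarrow \mathrm{Gr}(M,d^1)_w\times\mathrm{Fl}(N,\mathbf e)$$ such that, for every $U$ in the source, with $f(U)=(L,V)$ and $V=(V^0\subseteq\cdots\subseteq V^{r-1}=N)$, one has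 $L=p(U)$ and $\mathrm{sp}(U)=([N],\mathrm{sp}(V))$, where $\mathrm{sp}(V)=([N/V^k])_{1\le k\le r-1}$. -/

import Mathlib

open Module

universe u v w w'

noncomputable section

/-! ### Classical varieties inside products of projective spaces -/

section Polynomial

variable {K : Type u} [Field K] {J : Type} {W : J → Type w}
  [∀ j, AddCommGroup (W j)] [∀ j, Module K (W j)]

/-- Polynomial functions on `∏ j, W j`: the `K`-algebra of functions generated by the linear
forms. -/
def IsPolynomialFunction (K : Type u) [Field K] {J : Type} {W : J → Type w}
    [∀ j, AddCommGroup (W j)] [∀ j, Module K (W j)] (g : (∀ j, W j) → K) : Prop :=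
  g ∈ Algebra.adjoin K
    (Set.range fun (l : Dual K (∀ j, W j)) => (l : (∀ j, W j) → K))

/-- A vector of forms: a polynomial map `F : ∏ j, W j → W'` that is multihomogeneous, of degree
`δ j` in the variables of `W j`. (Used over infinite fields, where polynomials and polynomial
functions are the same.) -/
structure IsForm [Fintype J] {W' : Type w'} [AddCommGroup W'] [Module K W']
    (δ : J → ℕ) (F : (∀ j, W j) → W') : Prop where
  polynomial : ∀ l : Dual K W', IsPolynomialFunction K fun x => l (F x)
  homogeneous : ∀ (c : J → K) (x : ∀ j, W j),
    F (fun j => c j • x j) = (∏ j, c j ^ δ j) • F x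

end Polynomial

/-- A realization of a set `X` as a set of points of a finite product `∏ j, ℙ(W j)` of projective
spaces of finite-dimensional vector spaces. -/
structure MultiprojectiveSet (K : Type u) [Field K] (X : Type v) where
  J : Type
  [fintype : Fintype J]
  W : J → Type w
  [addCommGroup : ∀ j, AddCommGroup (W j)]
  [module : ∀ j, Module K (W j)]
  [finite : ∀ j, FiniteDimensional K (W j)]
  point : X → ∀ j, Projectivization K (W j)
  injective : Function.Injective point

attribute [instance] MultiprojectiveSet.fintype MultiprojectiveSet.addCommGroup
  MultiprojectiveSet.module MultiprojectiveSet.finite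

namespace MultiprojectiveSet

variable {K : Type u} [Field K]

/-- Homogeneous coordinates of a point. -/
def coord {X : Type v} (A : MultiprojectiveSet.{u, v, w} K X) (x : X) : ∀ j, A.W j :=
  fun j => (A.point x j).rep

/-- The structure induced on a subset. -/
def restrict {X : Type v} (A : MultiprojectiveSet.{u, v, w} K X) (S : Set X) :
    MultiprojectiveSet.{u, v, w} K S where
  J := A.J
  W := A.W
  point x := A.point x
  injective _ _ h := Subtype.ext (A.injective h)

/-- The product `X × Y` inside the product of the two ambient spaces. -/
def prod {X : Type v} {Y : Type w'} (A : MultiprojectiveSet.{u, v, w} K X)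
    (B : MultiprojectiveSet.{u, w', w} K Y) : MultiprojectiveSet.{u, max v w', w} K (X × Y) where
  J := A.J ⊕ B.J
  W := Sum.elim A.W B.W
  addCommGroup
    | .inl j => A.addCommGroup j
    | .inr j => B.addCommGroup j
  module
    | .inl j => A.module j
    | .inr j => B.module j
  finite
    | .inl j => A.finite j
    | .inr j => B.finite j
  point x
    | .inl j => A.point x.1 j
    | .inr j => B.point x.2 j
  injective _ _ h := Prod.ext
    (A.injective (funext fun j => congrFun h (.inl j)))
    (B.injective (funext fun j => congrFun h (.inr j)))

/-- Regular maps: every component `X → ℙ(B.W j)` is given, on a principal Zariski open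
neighbourhood `{G ≠ 0}` of any given point, by a vector of forms (of one multidegree, in the
homogeneous coordinates of `X`) without common zero there. -/
def IsRegularMap {X : Type v} {Y : Type w'} (A : MultiprojectiveSet.{u, v, w} K X)
    (B : MultiprojectiveSet.{u, w', w} K Y) (φ : X → Y) : Prop :=
  ∀ (x : X) (j : B.J), ∃ (γ δ : A.J → ℕ) (G : (∀ i, A.W i) → K) (F : (∀ i, A.W i) → B.W j),
    IsForm (K := K) γ G ∧ IsForm (K := K) δ F ∧ G (A.coord x) ≠ 0 ∧
      ∀ y : X, G (A.coord y) ≠ 0 →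
        ∃ h : F (A.coord y) ≠ 0, B.point (φ y) j = Projectivization.mk K (F (A.coord y)) h

/-- An isomorphism of varieties: a bijection that is regular in both directions. -/
def IsIsomorphism {X : Type v} {Y : Type w'} (A : MultiprojectiveSet.{u, v, w} K X)
    (B : MultiprojectiveSet.{u, w', w} K Y) (φ : X ≃ Y) : Prop :=
  A.IsRegularMap B φ ∧ B.IsRegularMap A φ.symm

end MultiprojectiveSet

/-! ### The Plücker embedding -/

section Pluecker

variable {K : Type u} [Field K] {V : Type v} [AddCommGroup V] [Module K V]

lemma finrank_plueckerLine [FiniteDimensional K V] {k : ℕ} {U : Submodule K V}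
    (hU : finrank K U = k) :
    finrank K (LinearMap.range (exteriorPower.map k U.subtype)) = 1 := by
  rw [LinearMap.finrank_range_of_inj
    (exteriorPower.map_injective_field U.injective_subtype),
    exteriorPower.finrank_eq, hU, Nat.choose_self]

/-- The Plücker point `[u₁ ∧ ⋯ ∧ u_k]` of a `k`-dimensional subspace `U = ⟨u₁, …, u_k⟩` of `V`:
the line `⋀ᵏ U ⊆ ⋀ᵏ V`. -/
def plueckerPoint [FiniteDimensional K V] {k : ℕ} (U : Submodule K V) (hU : finrank K U = k) :
    Projectivization K (⋀[K]^k V) :=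
  Projectivization.mk'' (LinearMap.range (exteriorPower.map k U.subtype))
    (finrank_plueckerLine hU)

lemma le_of_plueckerLine_eq [FiniteDimensional K V] {k : ℕ} {U U' : Submodule K V}
    (hU : finrank K U = k)
    (h : LinearMap.range (exteriorPower.map k U.subtype) =
      LinearMap.range (exteriorPower.map k U'.subtype)) : U ≤ U' := by
  intro x hx
  by_contra hx'
  obtain ⟨l, hlx, hl⟩ := Submodule.exists_le_ker_of_notMem hx'
  let g : V →ₗ[K] V := LinearMap.id - ((l x)⁻¹ • l).smulRight x
  have hgU' : g ∘ₗ U'.subtype = U'.subtype := by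
    ext y
    have : l (y : V) = 0 := hl y.2
    simp [g, this]
  have hgx : g x = 0 := by simp [g, hlx]
  set q := g ∘ₗ U.subtype with hq
  have hlt : finrank K (LinearMap.range q) < k := by
    have h1 := LinearMap.finrank_range_add_finrank_ker q
    have h2 : 0 < finrank K (LinearMap.ker q) := by
      have : Nontrivial (LinearMap.ker q) := by
        refine ⟨⟨⟨⟨x, hx⟩, by simpa [q] using hgx⟩, 0, ?_⟩⟩
        intro h0
        have : x = 0 := by simpa using h0
        exact hx' (this ▸ U'.zero_mem)
      exact Module.finrank_pos
    omega
  have hq0 : exteriorPower.map k q = 0 := by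
    have hf : q = (LinearMap.range q).subtype ∘ₗ q.rangeRestrict := by
      ext; simp
    have h0 : finrank K (⋀[K]^k (LinearMap.range q)) = 0 := by
      rw [exteriorPower.finrank_eq, Nat.choose_eq_zero_of_lt hlt]
    have : Subsingleton (⋀[K]^k (LinearMap.range q)) := Module.finrank_zero_iff.1 h0
    rw [hf, exteriorPower.map_comp,
      Subsingleton.elim (exteriorPower.map k q.rangeRestrict) 0, LinearMap.comp_zero]
  have hbot : LinearMap.range (exteriorPower.map k U.subtype) = ⊥ := by
    rw [eq_bot_iff]
    intro z hz
    obtain ⟨a, rfl⟩ := hz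
    obtain ⟨b, hb⟩ : exteriorPower.map k U.subtype a ∈
        LinearMap.range (exteriorPower.map k U'.subtype) := h ▸ ⟨a, rfl⟩
    have h1 : exteriorPower.map k g (exteriorPower.map k U.subtype a) = 0 := by
      have := LinearMap.congr_fun (exteriorPower.map_comp (n := k) U.subtype g) a
      rw [← hq, hq0] at this
      simpa using this.symm
    have h2 : exteriorPower.map k g (exteriorPower.map k U'.subtype b) =
        exteriorPower.map k U'.subtype b := by
      have := LinearMap.congr_fun (exteriorPower.map_comp (n := k) U'.subtype g) b
      rw [hgU'] at this
      simpa using this.symm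
    rw [← hb, h2, hb] at h1
    simpa using h1
  have h1 := finrank_plueckerLine hU
  rw [hbot, finrank_bot] at h1
  exact zero_ne_one h1

lemma plueckerPoint_injective [FiniteDimensional K V] {k : ℕ} {U U' : Submodule K V}
    (hU : finrank K U = k) (hU' : finrank K U' = k)
    (h : plueckerPoint U hU = plueckerPoint U' hU') : U = U' := by
  have h' := congrArg Projectivization.submodule h
  simp only [plueckerPoint, Projectivization.submodule_mk''] at h'
  exact le_antisymm (le_of_plueckerLine_eq hU h') (le_of_plueckerLine_eq hU' h'.symm)

end Pluecker

/-! ### Representations of the oriented cycle -/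

/-- A finite-dimensional representation of the oriented cycle with vertex set `ZMod n` and one
arrow `i → i + 1` for every vertex `i`. -/
structure CycleRep (K : Type u) [Field K] (n : ℕ) where
  V : ZMod n → Type v
  [addCommGroup : ∀ i, AddCommGroup (V i)]
  [module : ∀ i, Module K (V i)]
  [finite : ∀ i, FiniteDimensional K (V i)]
  map : ∀ i, V i →ₗ[K] V (i + 1)

attribute [instance] CycleRep.addCommGroup CycleRep.module CycleRep.finite

namespace CycleRep

variable {K : Type u} [Field K] {n : ℕ}

/-- The dimension vector. -/
def dimVec (M : CycleRep.{u, v} K n) : ZMod n → ℕ := fun i => finrank K (M.V i)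

/-- The sum of all arrows, acting on `⨁ i, V i`. -/
def arrowSum [NeZero n] (M : CycleRep.{u, v} K n) : (∀ i, M.V i) →ₗ[K] (∀ i, M.V i) :=
  ∑ i, LinearMap.single K M.V (i + 1) ∘ₗ M.map i ∘ₗ LinearMap.proj i

/-- For every vertex `i` the composite of the `n` maps once around the cycle, from `V i` to `V i`,
is nilpotent. On the summand `V i` this composite is the `n`-th power of `arrowSum`. -/
def IsNilpotent [NeZero n] (M : CycleRep.{u, v} K n) : Prop :=
  ∀ i, ∃ m : ℕ, ∀ x : M.V i, (((M.arrowSum ^ n) ^ m) (Pi.single i x)) = 0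

/-- Isomorphism of representations. -/
def Iso (M N : CycleRep.{u, v} K n) : Prop :=
  ∃ e : ∀ i, M.V i ≃ₗ[K] N.V i, ∀ i x, e (i + 1) (M.map i x) = N.map i (e i x)

instance isoSetoid (K : Type u) [Field K] (n : ℕ) : Setoid (CycleRep.{u, v} K n) where
  r := Iso
  iseqv :=
    { refl := fun _ => ⟨fun _ => LinearEquiv.refl K _, fun _ _ => rfl⟩
      symm := fun ⟨e, he⟩ => ⟨fun i => (e i).symm, fun i x => by
        rw [LinearEquiv.symm_apply_eq, he, LinearEquiv.apply_symm_apply]⟩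
      trans := fun ⟨e, he⟩ ⟨e', he'⟩ => ⟨fun i => (e i).trans (e' i), fun i x => by
        simp [he, he']⟩ }

/-- Isomorphism classes of representations. -/
def IsoClass (K : Type u) [Field K] (n : ℕ) : Type _ := Quotient (isoSetoid.{u, v} K n)

/-- The isomorphism class `[M]`. -/
def isoClass (M : CycleRep.{u, v} K n) : IsoClass.{u, v} K n := Quotient.mk (isoSetoid K n) M

/-- Subrepresentations. -/
@[ext]
structure SubRep (M : CycleRep.{u, v} K n) where
  carrier : ∀ i, Submodule K (M.V i)
  map_mem : ∀ i, ∀ x ∈ carrier i, M.map i x ∈ carrier (i + 1)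

namespace SubRep

variable {M : CycleRep.{u, v} K n}

instance : PartialOrder (SubRep M) :=
  PartialOrder.lift SubRep.carrier fun _ _ h => SubRep.ext h

instance : OrderBot (SubRep M) where
  bot := ⟨fun _ => ⊥, fun i x hx => by simp_all⟩
  bot_le _ := fun _ => bot_le

instance : OrderTop (SubRep M) where
  top := ⟨fun _ => ⊤, fun _ _ _ => trivial⟩
  le_top _ := fun _ => le_top

/-- The dimension vector of a subrepresentation. -/
def dimVec (U : SubRep M) : ZMod n → ℕ := fun i => finrank K (U.carrier i)

/-- The radical of `U`: the intersection of its maximal proper subrepresentations. -/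
def rad (U : SubRep M) : SubRep M where
  carrier i := U.carrier i ⊓ ⨅ (X : SubRep M) (_ : X ⋖ U), X.carrier i
  map_mem i x hx := by
    simp only [Submodule.mem_inf, Submodule.mem_iInf] at hx ⊢
    exact ⟨U.map_mem i x hx.1, fun X hX => X.map_mem i x (hx.2 X hX)⟩

/-- The quotient representation `M / U`. -/
def quot (U : SubRep M) : CycleRep.{u, v} K n where
  V i := M.V i ⧸ U.carrier i
  map i := (U.carrier i).mapQ (U.carrier (i + 1)) (M.map i) (U.map_mem i)

end SubRep

/-- The socle, as a graded subspace: the sum of all simple subrepresentations. -/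
def soc (M : CycleRep.{u, v} K n) (i : ZMod n) : Submodule K (M.V i) :=
  ⨆ (X : SubRep M) (_ : IsAtom X), X.carrier i

/-- The radical powers `radᵐ M`. -/
def radPow (M : CycleRep.{u, v} K n) : ℕ → SubRep M
  | 0 => ⊤
  | m + 1 => (radPow M m).rad

/-- A complete graded flag in `soc M` that refines the flag of all `soc M ∩ radᵐ M`, `m ≥ 0`. -/
structure SocleFlag (M : CycleRep.{u, v} K n) where
  W : ∀ i, Fin (finrank K (M.soc i) + 1) → Submodule K (M.V i)
  monotone : ∀ i, Monotone (W i)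
  finrank_eq : ∀ i l, finrank K (W i l) = l
  le_soc : ∀ i l, W i l ≤ M.soc i
  refines : ∀ i m, ∃ l, W i l = M.soc i ⊓ (M.radPow m).carrier i

/-! ### Quiver flag varieties -/

/-- Complete dimension filtrations `0 = d⁰ ≤ d¹ ≤ ⋯ ≤ dʳ`. -/
structure IsCompleteDimFiltration [NeZero n] {r : ℕ} (d : Fin (r + 1) → ZMod n → ℕ) : Prop where
  zero : d 0 = 0
  monotone : Monotone d
  step : ∀ k : Fin r, ∑ i, d k.succ i = ∑ i, d k.castSucc i + 1

/-- The quiver flag variety `Fl(M, d)`, as a set: flags `U⁰ ⊆ ⋯ ⊆ Uʳ = M` of subrepresentations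
with `dim Uᵏ = dᵏ`. -/
@[ext]
structure Fl (M : CycleRep.{u, v} K n) {r : ℕ} (d : Fin (r + 1) → ZMod n → ℕ) where
  U : Fin (r + 1) → SubRep M
  monotone : Monotone U
  last : U (Fin.last r) = ⊤
  dim : ∀ k, (U k).dimVec = d k

/-- The quiver Grassmannian `Gr(M, e)`, as a set. -/
def Gr (M : CycleRep.{u, v} K n) (e : ZMod n → ℕ) : Type v :=
  { L : SubRep M // L.dimVec = e }

/-- `Fl(M, d)` inside the product over `k` and `i` of the Plücker spaces of the Grassmannians of
`dᵏ i`-dimensional subspaces of `V i`. -/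
def flVariety [NeZero n] (M : CycleRep.{u, v} K n) {r : ℕ} (d : Fin (r + 1) → ZMod n → ℕ) :
    MultiprojectiveSet K (Fl M d) where
  J := Fin (r + 1) × ZMod n
  W j := ⋀[K]^(d j.1 j.2) (M.V j.2)
  point U j := plueckerPoint ((U.U j.1).carrier j.2) (congrFun (U.dim j.1) j.2)
  injective _ _ h := Fl.ext (funext fun k => SubRep.ext (funext fun i =>
    plueckerPoint_injective _ _ (congrFun h (k, i))))

/-- `Gr(M, e)` inside the product over `i` of the Plücker spaces of the Grassmannians of
`e i`-dimensional subspaces of `V i`. -/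
def grVariety [NeZero n] (M : CycleRep.{u, v} K n) (e : ZMod n → ℕ) :
    MultiprojectiveSet K (Gr M e) where
  J := ZMod n
  W i := ⋀[K]^(e i) (M.V i)
  point L i := plueckerPoint (L.1.carrier i) (congrFun L.2 i)
  injective _ _ h := Subtype.ext (SubRep.ext (funext fun i =>
    plueckerPoint_injective _ _ (congrFun h i)))

/-- The stratum of all `L` in `Gr(M, e)` whose relative position `dim (Lᵢ ∩ Wᵢˡ)` to the flag `W`
is `w`. -/
def grStratum (M : CycleRep.{u, v} K n) (e : ZMod n → ℕ) (W : M.SocleFlag)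
    (w : ∀ i, Fin (finrank K (M.soc i) + 1) → ℕ) : Set (Gr M e) :=
  { L | ∀ i l, finrank K (L.1.carrier i ⊓ W.W i l : Submodule K (M.V i)) = w i l }

/-- The map forgetting all but the first subspace `U¹`. -/
def forget {M : CycleRep.{u, v} K n} {r : ℕ} {d : Fin (r + 2) → ZMod n → ℕ} (U : Fl M d) :
    Gr M (d 1) :=
  ⟨U.U 1, U.dim 1⟩

/-- The isomorphism types `([M / Uᵏ])`, `1 ≤ k ≤ r`. -/
def sp {M : CycleRep.{u, v} K n} {r : ℕ} {d : Fin (r + 1) → ZMod n → ℕ} (U : Fl M d) :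
    Fin r → IsoClass.{u, v} K n :=
  fun k => (U.U k.succ).quot.isoClass

end CycleRep

end

/-! As `d 1` has total dimension one, each L in the stratum is a line in the socle at a single
vertex i₀. If B is the first step of the socle flag at i₀ containing U₀ and A is the step before it,
every L in the stratum is spanned by some x in B \ A. The key is a family of endomorphisms Φ_x of M,
linear in x, which for x in B \ A are automorphisms and send a fixed generator u₀ of U₀ to x
(`exists_linear_family`). Since the flag refines all soc ∩ radᵐ, there is an m with B ⊆ radᵐ and u₀
∉ A + radᵐ⁺¹. Hence some linear form λ has λ(u₀) = 1 and kills A and radᵐ⁺¹. Let T be the sum of the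
arrows and write x - λ(x)u₀ = Tᵐz with z linear in x. Then Φ_x v = λ(x)v + ∑_{k ≤ m} λ(Tᵏv) Tᵐ⁻ᵏz
commutes with T, and it is injective because its kernel contains no nonzero vector killed by an
arrow.

Composing Φ_x⁻¹ with M → N = M/U₀ gives a quotient map with kernel L, so flags above L are the
preimages of flags in N (`flEquiv`), with isomorphic quotients. For regularity, x is linear in the
Plücker coordinates of U¹, ⋀ᵏΦ_x is polynomial in x, and Φ_x⁻¹ may be replaced by the adjugate,
since scalars do not matter projectively. Passing between a subspace of V/U₀ and its preimage is
linear on Plücker coordinates because dim U₀ ≤ 1 (`exists_linearMap_plueckerLine_comap_mkQ`). So one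
global form describes each component, in both directions. -/

/-! ### Polynomial maps and forms, their exterior powers and adjugates -/

section Forms

variable {K : Type u} [Field K] {J : Type} {W : J → Type w}
  [∀ j, AddCommGroup (W j)] [∀ j, Module K (W j)]

namespace IsPolynomialFunction

lemma const (c : K) : IsPolynomialFunction K fun _ : (∀ j, W j) => c :=
  Subalgebra.algebraMap_mem (Algebra.adjoin K _) c

lemma linear (l : Dual K (∀ j, W j)) : IsPolynomialFunction K fun x => l x :=
  Algebra.subset_adjoin ⟨l, rfl⟩

lemma mul {f g : (∀ j, W j) → K} (hf : IsPolynomialFunction K f)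
    (hg : IsPolynomialFunction K g) : IsPolynomialFunction K fun x => f x * g x :=
  Subalgebra.mul_mem _ hf hg

lemma smul (c : K) {f : (∀ j, W j) → K} (hf : IsPolynomialFunction K f) :
    IsPolynomialFunction K fun x => c • f x :=
  Subalgebra.smul_mem _ hf c

lemma sum {ι : Type*} (s : Finset ι) {f : ι → (∀ j, W j) → K}
    (hf : ∀ i, IsPolynomialFunction K (f i)) : IsPolynomialFunction K fun x => ∑ i ∈ s, f i x := by
  have := Subalgebra.sum_mem _ (t := s) fun i _ => hf i
  unfold IsPolynomialFunction
  convert this using 1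
  ext x
  simp

lemma prod {ι : Type*} (s : Finset ι) {f : ι → (∀ j, W j) → K}
    (hf : ∀ i, IsPolynomialFunction K (f i)) : IsPolynomialFunction K fun x => ∏ i ∈ s, f i x := by
  have := Subalgebra.prod_mem _ (t := s) fun i _ => hf i
  unfold IsPolynomialFunction
  convert this using 1
  ext x
  simp

lemma zsmul_unit (c : ℤˣ) {f : (∀ j, W j) → K} (hf : IsPolynomialFunction K f) :
    IsPolynomialFunction K fun x => c • f x := by
  rcases Int.units_eq_one_or c with rfl | rfl
  · simpa using hf
  · simpa using smul (-1) hf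

end IsPolynomialFunction

/-- Polynomial maps: the components with respect to all linear forms are polynomial functions. -/
def IsPolynomialMap (K : Type u) [Field K] {J : Type} {W : J → Type w}
    [∀ j, AddCommGroup (W j)] [∀ j, Module K (W j)] {V : Type*} [AddCommGroup V] [Module K V]
    (F : (∀ j, W j) → V) : Prop :=
  ∀ l : Dual K V, IsPolynomialFunction K fun x => l (F x)

namespace IsPolynomialMap

variable {V V' : Type*} [AddCommGroup V] [Module K V] [AddCommGroup V'] [Module K V']

lemma comp {F : (∀ j, W j) → V} (hF : IsPolynomialMap K F) (L : V →ₗ[K] V') :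
    IsPolynomialMap K fun x => L (F x) :=
  fun l => hF (l ∘ₗ L)

lemma sum {ι : Type*} (s : Finset ι) {F : ι → (∀ j, W j) → V}
    (hF : ∀ i, IsPolynomialMap K (F i)) : IsPolynomialMap K fun x => ∑ i ∈ s, F i x := by
  intro l
  simp only [map_sum]
  exact IsPolynomialFunction.sum s fun i => hF i l

lemma smul {f : (∀ j, W j) → K} {F : (∀ j, W j) → V} (hf : IsPolynomialFunction K f)
    (hF : IsPolynomialMap K F) : IsPolynomialMap K fun x => f x • F x := by
  intro l
  simp only [map_smul, smul_eq_mul]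
  exact hf.mul (hF l)

lemma smul_const {f : (∀ j, W j) → K} (hf : IsPolynomialFunction K f) (e : V) :
    IsPolynomialMap K fun x => f x • e :=
  smul hf fun l => IsPolynomialFunction.const (l e)

lemma multilinear [FiniteDimensional K V] {k : ℕ}
    (f : MultilinearMap K (fun _ : Fin k => V) V') {F : Fin k → (∀ j, W j) → V}
    (hF : ∀ i, IsPolynomialMap K (F i)) : IsPolynomialMap K fun x => f fun i => F i x := by
  classical
  let b := finBasis K V
  have h : (fun x => f fun i => F i x) = fun x =>
      ∑ c : Fin k → Fin (finrank K V), (∏ i, b.coord (c i) (F i x)) • f fun i => b (c i) := by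
    ext x
    conv_lhs =>
      enter [2, i]
      rw [← b.sum_repr (F i x)]
    rw [f.map_sum]
    simp_rw [f.map_smul_univ]
    rfl
  rw [h]
  exact sum _ fun c => smul_const (IsPolynomialFunction.prod _ fun i => hF i _) _

/-- On a fixed decomposable vector v₁ ∧ ⋯ ∧ v_k the value is multilinear in the vectors A vᵢ; such
vectors span, and p is then expanded in a basis. -/
lemma exteriorMap [FiniteDimensional K V] [FiniteDimensional K V'] {k : ℕ}
    {A : (∀ j, W j) → V →ₗ[K] V'} {p : (∀ j, W j) → ⋀[K]^k V}
    (hA : IsPolynomialMap K A) (hp : IsPolynomialMap K p) :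
    IsPolynomialMap K fun x => exteriorPower.map k (A x) (p x) := by
  have key : ∀ q : ⋀[K]^k V, IsPolynomialMap K fun x => exteriorPower.map k (A x) q := by
    intro q
    have hq : q ∈ Submodule.span K (Set.range (exteriorPower.ιMulti K k (M := V))) := by
      rw [exteriorPower.ιMulti_span]; trivial
    induction hq using Submodule.span_induction with
    | mem q hq =>
      obtain ⟨v, rfl⟩ := hq
      simp only [exteriorPower.map_apply_ιMulti]
      exact multilinear (exteriorPower.ιMulti K k (M := V')).toMultilinearMap
        (F := fun i x => A x (v i)) fun i => hA.comp (LinearMap.applyₗ (v i))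
    | zero =>
      simp only [map_zero]
      exact fun l => IsPolynomialFunction.const _
    | add q q' _ _ h h' =>
      simp only [map_add]
      intro l
      simp only [map_add]
      exact Subalgebra.add_mem _ (h l) (h' l)
    | smul c q _ h =>
      simp only [map_smul]
      intro l
      simp only [map_smul]
      exact (h l).smul c
  let b := finBasis K (⋀[K]^k V)
  have h : (fun x => exteriorPower.map k (A x) (p x)) = fun x =>
      ∑ i, b.coord i (p x) • exteriorPower.map k (A x) (b i) := by
    ext1 x
    conv_lhs => rw [← b.sum_repr (p x), map_sum]
    simp only [map_smul, Basis.coord_apply]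
  rw [h]
  exact sum _ fun i => smul (hp _) (key _)

lemma matrix {ι : Type*} [Fintype ι] {A : (∀ j, W j) → Matrix ι ι K}
    (hA : ∀ i i', IsPolynomialFunction K fun x => A x i i') : IsPolynomialMap K A := by
  classical
  have h : A = fun x => ∑ i, ∑ i', A x i i' • Matrix.single i i' (1 : K) := by
    ext1 x
    conv_lhs => rw [Matrix.matrix_eq_sum_single (A x)]
    simp
  rw [h]
  exact sum _ fun i => sum _ fun i' => smul_const (hA i i') _

lemma adjugate {ι : Type*} [Fintype ι] [DecidableEq ι] {A : (∀ j, W j) → Matrix ι ι K}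
    (hA : ∀ i i', IsPolynomialFunction K fun x => A x i i') :
    IsPolynomialMap K fun x => (A x).adjugate := by
  refine matrix fun i i' => ?_
  simp only [Matrix.adjugate_apply, Matrix.det_apply]
  refine IsPolynomialFunction.sum _ fun s => IsPolynomialFunction.zsmul_unit _ <|
    IsPolynomialFunction.prod _ fun a => ?_
  -- The adjugate entry is the determinant of A with row i' replaced by a constant unit vector.
  by_cases h : s a = i'
  · simp only [h, Matrix.updateRow_self]
    exact IsPolynomialFunction.const _
  · simp only [Matrix.updateRow_ne h]
    exact hA _ _

end IsPolynomialMap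

lemma exteriorPower.map_smul_apply {V V' : Type*} [AddCommGroup V] [Module K V] [AddCommGroup V']
    [Module K V'] (k : ℕ) (c : K) (A : V →ₗ[K] V') (p : ⋀[K]^k V) :
    exteriorPower.map k (c • A) p = c ^ k • exteriorPower.map k A p := by
  have : exteriorPower.map k (c • A) = c ^ k • exteriorPower.map k A := by
    apply exteriorPower.linearMap_ext
    ext1 v
    simp only [LinearMap.compAlternatingMap_apply, LinearMap.smul_apply,
      exteriorPower.map_apply_ιMulti]
    refine ((exteriorPower.ιMulti K k (M := V')).toMultilinearMap.map_smul_univ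
      (fun _ => c) (A ∘ v)).trans ?_
    simp only [Finset.prod_const, Finset.card_univ, Fintype.card_fin]
    rfl
  rw [this, LinearMap.smul_apply]

/-- The adjugate of an endomorphism. -/
noncomputable def LinearMap.adjugate {V : Type*} [AddCommGroup V] [Module K V]
    [FiniteDimensional K V] (A : V →ₗ[K] V) : V →ₗ[K] V :=
  Matrix.toLin (finBasis K V) (finBasis K V)
    (LinearMap.toMatrix (finBasis K V) (finBasis K V) A).adjugate

/-- Makes the adjugate a polynomial substitute for the inverse: for invertible A they differ by the
scalar `det A`, which subspaces and projective points do not see. -/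
lemma LinearMap.comp_adjugate {V : Type*} [AddCommGroup V] [Module K V]
    [FiniteDimensional K V] (A : V →ₗ[K] V) (x : V) :
    A (A.adjugate x) = LinearMap.det A • x := by
  set b := finBasis K V with hb
  have h := congrArg (Matrix.toLin b b)
    (Matrix.mul_adjugate (LinearMap.toMatrix b b A))
  rw [Matrix.toLin_mul b b b, Matrix.toLin_toMatrix, LinearMap.det_toMatrix, map_smul,
    Matrix.toLin_one] at h
  exact LinearMap.congr_fun h x

namespace IsForm

variable [Fintype J] {V V' : Type*} [AddCommGroup V] [Module K V] [AddCommGroup V'] [Module K V']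

lemma proj [DecidableEq J] (j : J) : IsForm (K := K) (Pi.single j 1 : J → ℕ)
    fun x : (∀ j, W j) => x j := by
  refine ⟨fun l => IsPolynomialFunction.linear (l ∘ₗ LinearMap.proj j), fun c x => ?_⟩
  rw [Finset.prod_eq_single j]
  · simp
  · intro i _ hi
    simp [hi]
  · simp

lemma comp {δ : J → ℕ} {F : (∀ j, W j) → V} (hF : IsForm (K := K) δ F) (L : V →ₗ[K] V') :
    IsForm (K := K) δ fun x => L (F x) :=
  ⟨IsPolynomialMap.comp hF.polynomial L, fun c x => by rw [hF.homogeneous, map_smul]⟩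

lemma exteriorMap [FiniteDimensional K V] [FiniteDimensional K V'] {k : ℕ} {δ ε : J → ℕ}
    {A : (∀ j, W j) → V →ₗ[K] V'} {p : (∀ j, W j) → ⋀[K]^k V}
    (hA : IsForm (K := K) δ A) (hp : IsForm (K := K) ε p) :
    IsForm (K := K) (k • δ + ε) fun x => exteriorPower.map k (A x) (p x) := by
  refine ⟨IsPolynomialMap.exteriorMap hA.polynomial hp.polynomial, fun c x => ?_⟩
  rw [hA.homogeneous, hp.homogeneous, exteriorPower.map_smul_apply, map_smul, smul_smul,
    ← Finset.prod_pow, ← Finset.prod_mul_distrib]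
  congr 1
  refine Finset.prod_congr rfl fun j _ => ?_
  simp [pow_add, ← pow_mul, mul_comm]

lemma adjugate [FiniteDimensional K V] {δ : J → ℕ} {A : (∀ j, W j) → V →ₗ[K] V}
    (hA : IsForm (K := K) δ A) :
    IsForm (K := K) ((finrank K V - 1) • δ) fun x => (A x).adjugate := by
  set b := finBasis K V with hb
  refine ⟨?_, fun c x => ?_⟩
  · refine IsPolynomialMap.comp (IsPolynomialMap.adjugate fun i i' => ?_)
      (Matrix.toLin b b).toLinearMap
    exact hA.polynomial (Matrix.entryLinearMap K K i i' ∘ₗ (LinearMap.toMatrix b b).toLinearMap)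
  · rw [hA.homogeneous]
    simp only [LinearMap.adjugate, map_smul, Matrix.adjugate_smul, Fintype.card_fin]
    congr 1
    rw [← Finset.prod_pow]
    refine Finset.prod_congr rfl fun j _ => ?_
    simp [← pow_mul, mul_comm]

end IsForm

end Forms

/-! ### Plücker lines of images and of preimages under a quotient map -/

section Pluecker

variable {K : Type u} [Field K] {V : Type v} [AddCommGroup V] [Module K V]

/-- The line `⋀ᵏ S ⊆ ⋀ᵏ V` of a subspace `S`. -/
noncomputable abbrev plueckerLine (k : ℕ) (S : Submodule K V) : Submodule K (⋀[K]^k V) :=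
  LinearMap.range (exteriorPower.map k S.subtype)

lemma ιMulti_mem_plueckerLine {k : ℕ} {S : Submodule K V} {a : Fin k → V} (ha : ∀ i, a i ∈ S) :
    exteriorPower.ιMulti K k a ∈ plueckerLine k S :=
  ⟨exteriorPower.ιMulti K k fun i => ⟨a i, ha i⟩, by
    rw [exteriorPower.map_apply_ιMulti]; rfl⟩

lemma plueckerLine_eq_span (k : ℕ) (S : Submodule K V) :
    plueckerLine k S =
      Submodule.span K (exteriorPower.ιMulti K k '' {a : Fin k → V | ∀ i, a i ∈ S}) := by
  apply le_antisymm
  · rw [plueckerLine, LinearMap.range_eq_map, ← exteriorPower.ιMulti_span, Submodule.map_span]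
    apply Submodule.span_mono
    rintro _ ⟨_, ⟨a, rfl⟩, rfl⟩
    exact ⟨fun i => a i, fun i => (a i).2, by rw [exteriorPower.map_apply_ιMulti]; rfl⟩
  · rw [Submodule.span_le]
    rintro _ ⟨a, ha, rfl⟩
    exact ιMulti_mem_plueckerLine ha

lemma map_mem_plueckerLine {V' : Type*} [AddCommGroup V'] [Module K V'] {k : ℕ}
    {S : Submodule K V} {S' : Submodule K V'} {g : V →ₗ[K] V'} (hg : ∀ x ∈ S, g x ∈ S')
    {p : ⋀[K]^k V} (hp : p ∈ plueckerLine k S) :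
    exteriorPower.map k g p ∈ plueckerLine k S' := by
  obtain ⟨q, rfl⟩ := hp
  refine ⟨exteriorPower.map k (g.restrict hg) q, ?_⟩
  rw [← LinearMap.comp_apply, ← LinearMap.comp_apply, ← exteriorPower.map_comp,
    ← exteriorPower.map_comp]
  rfl

variable [FiniteDimensional K V]

lemma plueckerPoint_rep_mem {k : ℕ} {S : Submodule K V} (hS : finrank K S = k) :
    (plueckerPoint S hS).rep ∈ plueckerLine k S := by
  have h := (plueckerPoint S hS).submodule_eq
  rw [plueckerPoint, Projectivization.submodule_mk''] at h
  rw [plueckerLine, h]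
  exact Submodule.mem_span_singleton_self _

/-- The Plücker line is one-dimensional. Checking a formula for Plücker coordinates thus reduces to
membership in this line and nonvanishing. -/
lemma plueckerPoint_eq_mk {k : ℕ} {S : Submodule K V} (hS : finrank K S = k) {p : ⋀[K]^k V}
    (hp : p ∈ plueckerLine k S) (h0 : p ≠ 0) :
    plueckerPoint S hS = Projectivization.mk K p h0 := by
  apply Projectivization.submodule_injective
  rw [plueckerPoint, Projectivization.submodule_mk'', Projectivization.submodule_mk]
  symm
  refine Submodule.eq_of_le_of_finrank_eq ((Submodule.span_singleton_le_iff_mem _ _).2 hp) ?_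
  rw [finrank_span_singleton h0, finrank_plueckerLine hS]

omit [FiniteDimensional K V] in
-- This is ⋀¹V = V. The exponent stays a variable since it will be `d 1 i₀`, which equals 1 only
-- propositionally.
lemma exists_linearMap_plueckerLine_of_eq_one {k : ℕ} (hk : k = 1) :
    ∃ τ : ⋀[K]^k V →ₗ[K] V, Function.Injective τ ∧
      ∀ (S : Submodule K V), ∀ p ∈ plueckerLine k S, τ p ∈ S := by
  subst hk
  refine ⟨(exteriorPower.oneEquiv K V).toLinearMap, (exteriorPower.oneEquiv K V).injective,
    fun S p hp => ?_⟩
  obtain ⟨q, rfl⟩ := hp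
  have := LinearMap.congr_fun (exteriorPower.oneEquiv_naturality S.subtype) q
  simp only [LinearMap.comp_apply] at this
  erw [this]
  exact Subtype.prop _

omit [FiniteDimensional K V] in
-- The exterior algebra is the Clifford algebra of the zero form, and contraction with l is an
-- antiderivation.
lemma contractLeft_ιMulti {k : ℕ} (l : Dual K V) {a : Fin k → V} (ha : ∀ i, l (a i) = 0) :
    CliffordAlgebra.contractLeft (Q := (0 : QuadraticForm K V)) l
      (ExteriorAlgebra.ιMulti K k a) = 0 := by
  induction k with
  | zero =>
    rw [ExteriorAlgebra.ιMulti_zero_apply]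
    exact CliffordAlgebra.contractLeft_one _ _
  | succ k ih =>
    rw [ExteriorAlgebra.ιMulti_succ_apply]
    refine (CliffordAlgebra.contractLeft_ι_mul l (a 0) _).trans ?_
    erw [ih fun i => ha i.succ]
    simp [ha]

omit [FiniteDimensional K V] in
/-- Wedging with a vector is injective on `⋀ᵏ` of a complementary hyperplane. -/
lemma wedge_injective {V' : Type*} [AddCommGroup V'] [Module K V'] {k : ℕ} (u : V)
    (s : V' →ₗ[K] V) (hs : Function.Injective s) (hu : u ∉ LinearMap.range s) :
    Function.Injective (exteriorPower.alternatingMapLinearEquiv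
      (((exteriorPower.ιMulti K (k + 1) (M := V)).curryLeft u).compLinearMap s)) := by
  obtain ⟨l, hlu, hl⟩ := Submodule.exists_le_ker_of_notMem hu
  rw [← LinearMap.ker_eq_bot, LinearMap.ker_eq_bot']
  intro q hq
  -- As l vanishes on the range of s, contracting u ∧ ⋀ᵏs(q) with l recovers ⋀ᵏs(q) up to the
  -- nonzero factor l(u).
  have hcontr : ∀ q : ⋀[K]^k V',
      CliffordAlgebra.contractLeft (Q := (0 : QuadraticForm K V)) l
        (exteriorPower.alternatingMapLinearEquiv
          (((exteriorPower.ιMulti K (k + 1) (M := V)).curryLeft u).compLinearMap s) q :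
            ⋀[K]^(k + 1) V).1 = l u • (exteriorPower.map k s q : ⋀[K]^k V).1 := by
    intro q
    have hq : q ∈ Submodule.span K (Set.range (exteriorPower.ιMulti K k (M := V'))) := by
      rw [exteriorPower.ιMulti_span]; trivial
    induction hq using Submodule.span_induction with
    | mem q hq =>
      obtain ⟨a, rfl⟩ := hq
      rw [exteriorPower.alternatingMapLinearEquiv_apply_ιMulti, exteriorPower.map_apply_ιMulti]
      simp only [AlternatingMap.compLinearMap_apply, AlternatingMap.curryLeft_apply_apply,
        exteriorPower.ιMulti_apply_coe]
      rw [ExteriorAlgebra.ιMulti_succ_apply]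
      refine (CliffordAlgebra.contractLeft_ι_mul l _ _).trans ?_
      erw [contractLeft_ιMulti l (a := fun i => s (a i)) fun i => hl ⟨a i, rfl⟩]
      simp
      rfl
    | zero => simp
    | add q q' _ _ h h' => simp only [map_add, Submodule.coe_add, h, h', smul_add]
    | smul c q _ h => simp only [map_smul, Submodule.coe_smul, h, smul_comm c]
  have h := hcontr q
  rw [hq] at h
  simp only [ZeroMemClass.coe_zero, map_zero] at h
  have h0 : exteriorPower.map k s q = 0 := by
    rcases smul_eq_zero.1 h.symm with h | h
    · exact absurd h hlu
    · exact Subtype.ext h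
  exact (map_eq_zero_iff _ (exteriorPower.map_injective_field hs)).1 h0

lemma Submodule.finrank_comap_of_surjective {V' : Type*} [AddCommGroup V'] [Module K V']
    {f : V →ₗ[K] V'} (hf : Function.Surjective f) (S : Submodule K V') :
    finrank K (S.comap f) = finrank K S + finrank K (LinearMap.ker f) := by
  have h := LinearMap.finrank_range_add_finrank_ker (f.domRestrict (S.comap f))
  have hle : LinearMap.ker f ≤ S.comap f := fun x hx => by
    rw [Submodule.mem_comap, LinearMap.mem_ker.1 hx]
    exact S.zero_mem
  rw [LinearMap.range_domRestrict, Submodule.map_comap_eq_of_surjective hf,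
    LinearMap.ker_domRestrict] at h
  rw [← h, ← (Submodule.comapSubtypeEquivOfLe hle).finrank_eq]

/-- With s a linear section of V → V/U, the preimage of S is U ⊕ s(S). So ω is ⋀s if U = 0, and ⋀s
followed by wedging with u if U = ⟨u⟩. -/
lemma exists_linearMap_plueckerLine_comap_mkQ (U : Submodule K V) {e k k' : ℕ}
    (hU : finrank K U = e) (he : e ≤ 1) (hk : k = k' + e) :
    ∃ ω : ⋀[K]^k' (V ⧸ U) →ₗ[K] ⋀[K]^k V, Function.Injective ω ∧
      ∀ S : Submodule K (V ⧸ U), ∀ q ∈ plueckerLine k' S, ω q ∈ plueckerLine k (S.comap U.mkQ) := by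
  obtain ⟨s, hs⟩ := U.mkQ.exists_rightInverse_of_surjective (Submodule.range_mkQ U)
  have hs' : ∀ x, U.mkQ (s x) = x := LinearMap.congr_fun hs
  have hsinj : Function.Injective s := Function.LeftInverse.injective hs'
  interval_cases e
  · subst hk
    refine ⟨exteriorPower.map _ s, exteriorPower.map_injective_field hsinj, fun S q hq => ?_⟩
    refine map_mem_plueckerLine (fun x hx => ?_) hq
    rw [Submodule.mem_comap, hs']
    exact hx
  · subst hk
    obtain ⟨u, hu0, -⟩ := finrank_eq_one_iff'.1 hU
    have hu : (u : V) ∉ LinearMap.range s := by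
      rintro ⟨x, hx⟩
      have : x = 0 := by
        rw [← hs' x, hx]
        simp
      rw [this, map_zero] at hx
      exact hu0 (Subtype.ext hx.symm)
    refine ⟨_, wedge_injective (u : V) s hsinj hu, fun S q hq => ?_⟩
    rw [plueckerLine_eq_span] at hq
    induction hq using Submodule.span_induction with
    | mem q hq =>
      obtain ⟨a, ha, rfl⟩ := hq
      rw [exteriorPower.alternatingMapLinearEquiv_apply_ιMulti]
      refine ιMulti_mem_plueckerLine (fun i => ?_)
      refine Fin.cases ?_ (fun i => ?_) i
      · change U.mkQ (u : V) ∈ S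
        rw [Submodule.mkQ_apply, (Submodule.Quotient.mk_eq_zero U).2 u.2]
        exact S.zero_mem
      · change U.mkQ (s (a i)) ∈ S
        rw [hs']
        exact ha i
    | zero => simp
    | add q q' _ _ h h' => rw [map_add]; exact add_mem h h'
    | smul c q _ h => rw [map_smul]; exact Submodule.smul_mem _ _ h

/-- Any linear left inverse of ω works: ω maps the line of S onto that of its preimage, both being
one-dimensional. -/
lemma exists_leftInverse_plueckerLine_comap_mkQ (U : Submodule K V) {e k k' : ℕ}
    (hU : finrank K U = e) (he : e ≤ 1) (hk : k = k' + e) :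
    ∃ ρ : ⋀[K]^k V →ₗ[K] ⋀[K]^k' (V ⧸ U), ∀ S : Submodule K (V ⧸ U), finrank K S = k' →
      ∀ p ∈ plueckerLine k (S.comap U.mkQ), p ≠ 0 → ρ p ∈ plueckerLine k' S ∧ ρ p ≠ 0 := by
  obtain ⟨ω, hω, hωS⟩ := exists_linearMap_plueckerLine_comap_mkQ U hU he hk
  obtain ⟨ρ, hρ⟩ := ω.exists_leftInverse_of_injective (LinearMap.ker_eq_bot.2 hω)
  have hρ' : ∀ q, ρ (ω q) = q := LinearMap.congr_fun hρ
  refine ⟨ρ, fun S hS p hp hp0 => ?_⟩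
  have hdim : finrank K (S.comap U.mkQ) = k := by
    rw [Submodule.finrank_comap_of_surjective U.mkQ_surjective, Submodule.ker_mkQ, hS, hU, hk]
  have hmap : (plueckerLine k' S).map ω = plueckerLine k (S.comap U.mkQ) := by
    refine Submodule.eq_of_le_of_finrank_eq (Submodule.map_le_iff_le_comap.2 (hωS S)) ?_
    rw [← (Submodule.equivMapOfInjective ω hω _).finrank_eq, finrank_plueckerLine hS,
      finrank_plueckerLine hdim]
  rw [← hmap] at hp
  obtain ⟨q, hq, rfl⟩ := hp
  rw [hρ']
  exact ⟨hq, fun h => hp0 (by rw [h, map_zero])⟩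

end Pluecker

lemma LinearMap.exists_section_on_range {K E E' : Type*} [Field K] [AddCommGroup E] [Module K E]
    [AddCommGroup E'] [Module K E'] (f : E →ₗ[K] E') :
    ∃ s : E' →ₗ[K] E, ∀ y ∈ LinearMap.range f, f (s y) = y := by
  obtain ⟨s, hs⟩ := f.rangeRestrict.exists_rightInverse_of_surjective f.range_rangeRestrict
  obtain ⟨t, ht⟩ := s.exists_extend
  refine ⟨t, fun y hy => ?_⟩
  have h1 := LinearMap.congr_fun ht ⟨y, hy⟩
  have h2 := congrArg Subtype.val (LinearMap.congr_fun hs ⟨y, hy⟩)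
  simp only [LinearMap.comp_apply, Submodule.subtype_apply] at h1
  simp only [LinearMap.comp_apply, LinearMap.id_apply] at h2
  rw [h1]
  exact h2

/-! ### Socle and radical powers of a nilpotent representation -/

namespace CycleRep

variable {K : Type u} [Field K] {n : ℕ} [NeZero n] {M : CycleRep.{u, v} K n}

omit [NeZero n] in
lemma exists_eq_add_one (i : ZMod n) : ∃ j, i = j + 1 := ⟨i - 1, by ring⟩

lemma arrowSum_apply_succ (x : ∀ i, M.V i) (i : ZMod n) :
    M.arrowSum x (i + 1) = M.map i (x i) := by
  simp only [arrowSum, LinearMap.sum_apply, Finset.sum_apply, LinearMap.comp_apply,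
    LinearMap.proj_apply, LinearMap.single_apply]
  rw [Finset.sum_eq_single i]
  · simp
  · intro j _ hj
    rw [Pi.single_eq_of_ne]
    intro h
    exact hj (add_right_cancel h).symm
  · simp

lemma arrowSum_single (i : ZMod n) (x : M.V i) :
    M.arrowSum (Pi.single i x) = Pi.single (i + 1) (M.map i x) := by
  funext j
  obtain ⟨k, rfl⟩ := exists_eq_add_one j
  rw [arrowSum_apply_succ]
  by_cases h : k = i
  · subst h
    simp
  · rw [Pi.single_eq_of_ne h, map_zero, Pi.single_eq_of_ne]
    intro h'
    exact h (add_right_cancel h')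

lemma IsNilpotent.exists_arrowSum_pow_eq_zero (hM : M.IsNilpotent) :
    ∃ N, M.arrowSum ^ N = 0 := by
  choose m hm using hM
  -- The sum of the exponents serves all vertices at once.
  refine ⟨n * ∑ i, m i, ?_⟩
  refine LinearMap.pi_ext fun i x => ?_
  rw [pow_mul, ← Finset.sum_erase_add _ _ (Finset.mem_univ i), pow_add, Module.End.mul_apply,
    hm i x, map_zero, LinearMap.zero_apply]

/-- Otherwise a nonzero homogeneous vector of X would stay nonzero under all powers of the arrow
sum. -/
lemma IsNilpotent.exists_mem_ker (hM : M.IsNilpotent) {X : SubRep M} (hX : X ≠ ⊥) :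
    ∃ i, ∃ v ∈ X.carrier i, v ≠ 0 ∧ M.map i v = 0 := by
  by_contra! h
  obtain ⟨i, v, hv, hv0⟩ : ∃ i, ∃ v ∈ X.carrier i, v ≠ 0 := by
    by_contra! h'
    exact hX (SubRep.ext (funext fun i => (Submodule.eq_bot_iff _).2 (h' i)))
  have key : ∀ k : ℕ, ∃ j, ∃ w ∈ X.carrier j, w ≠ 0 ∧
      (M.arrowSum ^ k) (Pi.single i v) = Pi.single j w := by
    intro k
    induction k with
    | zero => exact ⟨i, v, hv, hv0, rfl⟩
    | succ k ih =>
      obtain ⟨j, w, hw, hw0, hk⟩ := ih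
      refine ⟨j + 1, M.map j w, X.map_mem j w hw, h j w hw hw0, ?_⟩
      rw [pow_succ', Module.End.mul_apply, hk, arrowSum_single]
  obtain ⟨N, hN⟩ := hM.exists_arrowSum_pow_eq_zero
  obtain ⟨j, w, -, hw0, hk⟩ := key N
  rw [hN, LinearMap.zero_apply] at hk
  exact hw0 ((Pi.single_eq_zero_iff).1 hk.symm)

/-- In a simple subrepresentation the kernels of the arrows form a nonzero subrepresentation, hence
everything. -/
lemma IsNilpotent.soc_le_ker (hM : M.IsNilpotent) (i : ZMod n) :
    M.soc i ≤ LinearMap.ker (M.map i) := by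
  refine iSup₂_le fun X hX => ?_
  let Y : SubRep M := ⟨fun j => X.carrier j ⊓ LinearMap.ker (M.map j), fun j x hx => by
    rw [(LinearMap.mem_ker.1 hx.2)]
    exact Submodule.zero_mem _⟩
  have hYX : Y ≤ X := fun j => inf_le_left
  have hY : Y ≠ ⊥ := by
    obtain ⟨j, v, hv, hv0, hk⟩ := hM.exists_mem_ker hX.1
    intro h
    have : v ∈ Y.carrier j := ⟨hv, hk⟩
    rw [h] at this
    exact hv0 this
  rcases hX.le_iff.1 hYX with h | h
  · exact absurd h hY
  · rw [← h]
    exact inf_le_right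

lemma SubRep.le_soc {L : SubRep M} (hL : ∑ i, L.dimVec i = 1) (i : ZMod n) :
    L.carrier i ≤ M.soc i := by
  have hatom : IsAtom L := by
    refine ⟨?_, fun X hX => ?_⟩
    · rintro rfl
      have : ∑ i, (⊥ : SubRep M).dimVec i = 0 :=
        Finset.sum_eq_zero fun i _ => finrank_bot K (M.V i)
      omega
    · have hle : ∀ j, X.carrier j ≤ L.carrier j := hX.le
      have hdim : ∀ j ∈ Finset.univ, finrank K (X.carrier j) ≤ finrank K (L.carrier j) :=
        fun j _ => Submodule.finrank_mono (hle j)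
      have hlt : ∑ j, finrank K (X.carrier j) < ∑ j, finrank K (L.carrier j) := by
        refine lt_of_le_of_ne (Finset.sum_le_sum hdim) fun h => hX.ne ?_
        rw [Finset.sum_eq_sum_iff_of_le hdim] at h
        exact SubRep.ext (funext fun j =>
          Submodule.eq_of_le_of_finrank_eq (hle j) (h j (Finset.mem_univ j)))
      have h0 : ∑ j, finrank K (X.carrier j) = 0 := by
        have : ∑ j, finrank K (L.carrier j) = 1 := hL
        omega
      rw [Finset.sum_eq_zero_iff] at h0
      exact SubRep.ext (funext fun j => Submodule.finrank_eq_zero.1 (h0 j (Finset.mem_univ j)))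
  exact le_iSup₂_of_le L hatom le_rfl

/-- The image of a subrepresentation under all arrows. -/
def SubRep.image (U : SubRep M) : SubRep M where
  carrier j := (Submodule.pi Set.univ U.carrier).map (LinearMap.proj j ∘ₗ M.arrowSum)
  map_mem j x hx := by
    obtain ⟨y, hy, rfl⟩ := hx
    refine ⟨M.arrowSum y, fun k _ => ?_, ?_⟩
    · obtain ⟨k, rfl⟩ := exists_eq_add_one k
      rw [arrowSum_apply_succ]
      exact U.map_mem k _ (hy k trivial)
    · simp [arrowSum_apply_succ]

lemma SubRep.image_le (U : SubRep M) : U.image ≤ U := by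
  rintro j _ ⟨y, hy, rfl⟩
  obtain ⟨k, rfl⟩ := exists_eq_add_one j
  simp only [LinearMap.comp_apply, LinearMap.proj_apply, arrowSum_apply_succ]
  exact U.map_mem k _ (hy k trivial)

lemma SubRep.map_mem_image (U : SubRep M) {i : ZMod n} {x : M.V i} (hx : x ∈ U.carrier i) :
    M.map i x ∈ U.image.carrier (i + 1) := by
  refine ⟨Pi.single i x, fun k _ => ?_, ?_⟩
  · by_cases h : k = i
    · subst h
      simpa using hx
    · simp [Pi.single_eq_of_ne h]
  · simp [arrowSum_apply_succ]

/-- Nakayama's lemma. -/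
lemma IsNilpotent.le_of_le_sup_image (hM : M.IsNilpotent) {X U : SubRep M}
    (h : ∀ i, U.carrier i ≤ X.carrier i ⊔ U.image.carrier i) : U ≤ X := by
  set T := M.arrowSum
  set XE : Submodule K (∀ i, M.V i) := Submodule.pi Set.univ X.carrier
  set UE : Submodule K (∀ i, M.V i) := Submodule.pi Set.univ U.carrier
  have hTX : ∀ x ∈ XE, T x ∈ XE := by
    intro x hx k _
    obtain ⟨k, rfl⟩ := exists_eq_add_one k
    rw [arrowSum_apply_succ]
    exact X.map_mem k _ (hx k trivial)
  have hTkX : ∀ k : ℕ, ∀ x ∈ XE, (T ^ k) x ∈ XE := by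
    intro k
    induction k with
    | zero => exact fun x hx => hx
    | succ k ih =>
      intro x hx
      rw [pow_succ, Module.End.mul_apply]
      exact ih _ (hTX x hx)
  have hstep : ∀ u ∈ UE, ∃ x ∈ XE, ∃ u' ∈ UE, u = x + T u' := by
    intro u hu
    have : ∀ i, ∃ x ∈ X.carrier i, ∃ y : ∀ j, M.V j, y ∈ UE ∧ x + T y i = u i := by
      intro i
      obtain ⟨x, hx, _, ⟨y, hy, rfl⟩, hxy⟩ := Submodule.mem_sup.1 (h i (hu i trivial))
      exact ⟨x, hx, y, hy, hxy⟩
    choose x hx y hy hxy using this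
    -- The witness for vertex i + 1 matters only through its component at i, so these components
    -- combine into one vector.
    refine ⟨x, fun i _ => hx i, fun i => y (i + 1) i, fun i _ => hy (i + 1) i trivial, ?_⟩
    funext i
    obtain ⟨i, rfl⟩ := exists_eq_add_one i
    rw [← hxy, Pi.add_apply, arrowSum_apply_succ, arrowSum_apply_succ]
  -- Iterating U ⊆ X + TU gives U ⊆ X + TᵏU, and Tᵏ vanishes for large k.
  have hpow : ∀ k : ℕ, ∀ u ∈ UE, ∃ x ∈ XE, ∃ u' ∈ UE, u = x + (T ^ k) u' := by
    intro k
    induction k with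
    | zero => exact fun u hu => ⟨0, XE.zero_mem, u, hu, by simp⟩
    | succ k ih =>
      intro u hu
      obtain ⟨x, hx, u', hu', rfl⟩ := ih u hu
      obtain ⟨x', hx', u'', hu'', rfl⟩ := hstep u' hu'
      refine ⟨x + (T ^ k) x', XE.add_mem hx (hTkX k x' hx'), u'', hu'', ?_⟩
      rw [map_add, pow_succ, Module.End.mul_apply, add_assoc]
  obtain ⟨N, hN⟩ := hM.exists_arrowSum_pow_eq_zero
  intro i v hv
  have hvE : (Pi.single i v : ∀ j, M.V j) ∈ UE := by
    intro k _
    by_cases h : k = i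
    · subst h
      simpa using hv
    · simp [Pi.single_eq_of_ne h]
  obtain ⟨x, hx, u', -, hxu⟩ := hpow N _ hvE
  rw [hN, LinearMap.zero_apply, add_zero] at hxu
  have := hx i trivial
  rw [← hxu] at this
  simpa using this

/-- X plus the image lies between X and U; if it were U, Nakayama would give U ≤ X. -/
lemma IsNilpotent.image_le_of_covBy (hM : M.IsNilpotent) {X U : SubRep M} (hX : X ⋖ U) :
    U.image ≤ X := by
  let Y : SubRep M := ⟨fun j => X.carrier j ⊔ U.image.carrier j, fun j x hx => by
    obtain ⟨y, hy, z, hz, rfl⟩ := Submodule.mem_sup.1 hx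
    rw [map_add]
    exact Submodule.add_mem_sup (X.map_mem j y hy) (U.image.map_mem j z hz)⟩
  have hXY : X ≤ Y := fun j => le_sup_left
  have hYU : Y ≤ U := fun j => sup_le (hX.le j) (U.image_le j)
  rcases hX.eq_or_eq hXY hYU with h | h
  · rw [← h]
    exact fun j => le_sup_right
  · exact absurd (hM.le_of_le_sup_image fun i => (congrFun (congrArg SubRep.carrier h) i).ge)
      hX.lt.not_ge

/-- Only one arrow ends at i + 1, so cutting U there by a hyperplane containing the image of this
arrow leaves a maximal subrepresentation. -/
lemma SubRep.exists_covBy_notMem (U : SubRep M) {i : ZMod n} {v : M.V (i + 1)}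
    (hv : v ∈ U.carrier (i + 1)) (hv' : v ∉ (U.carrier i).map (M.map i)) :
    ∃ X : SubRep M, X ⋖ U ∧ v ∉ X.carrier (i + 1) := by
  obtain ⟨l, hlv, hl⟩ := Submodule.exists_le_ker_of_notMem hv'
  -- This is l at vertex i + 1 and zero elsewhere, written without transport along equalities of
  -- vertices.
  let l' (j : ZMod n) : M.V j →ₗ[K] K := l ∘ₗ LinearMap.proj (i + 1) ∘ₗ LinearMap.single K M.V j
  have hl' : l' (i + 1) = l := by
    ext x
    simp [l']
  have hl'ne : ∀ j, j ≠ i + 1 → l' j = 0 := by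
    intro j hj
    ext x
    simp [l', Pi.single_eq_of_ne hj.symm]
  let X : SubRep M := ⟨fun j => U.carrier j ⊓ LinearMap.ker (l' j), fun j x hx => by
    refine ⟨U.map_mem j x hx.1, ?_⟩
    rw [SetLike.mem_coe, LinearMap.mem_ker]
    simp only [l', LinearMap.comp_apply, LinearMap.proj_apply, LinearMap.single_apply]
    rw [← arrowSum_single, arrowSum_apply_succ]
    refine hl ⟨_, ?_, rfl⟩
    by_cases h : i = j
    · subst h
      simpa using hx.1
    · simp [Pi.single_eq_of_ne h]⟩
  have hvX : v ∉ X.carrier (i + 1) := by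
    intro h
    have := h.2
    rw [hl'] at this
    exact hlv this
  have hXU : X ≤ U := fun j => inf_le_left
  refine ⟨X, ⟨lt_of_le_of_ne hXU fun h => hvX (h ▸ hv), fun Y hXY hYU => ?_⟩, hvX⟩
  obtain ⟨j, y, hy, hyX⟩ : ∃ j, ∃ y ∈ Y.carrier j, y ∉ X.carrier j := by
    by_contra! h
    exact hXY.not_ge h
  have hy0 : l' j y ≠ 0 := fun h => hyX ⟨hYU.le j hy, h⟩
  have hj : j = i + 1 := by
    by_contra h
    rw [hl'ne j h] at hy0
    exact hy0 rfl
  subst hj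
  refine hYU.not_ge fun k x hx => ?_
  by_cases hk : k = i + 1
  · subst hk
    have h1 : x - (l' (i + 1) x / l' (i + 1) y) • y ∈ X.carrier (i + 1) := by
      refine ⟨Submodule.sub_mem _ hx (Submodule.smul_mem _ _ (hYU.le _ hy)), ?_⟩
      rw [SetLike.mem_coe, LinearMap.mem_ker, map_sub, map_smul, smul_eq_mul, div_mul_cancel₀ _ hy0, sub_self]
    have h2 := Submodule.add_mem _ (hXY.le _ h1)
      (Submodule.smul_mem _ (l' (i + 1) x / l' (i + 1) y) hy)
    rwa [sub_add_cancel] at h2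
  · refine hXY.le k ⟨hx, ?_⟩
    rw [hl'ne k hk]
    exact LinearMap.mem_ker.2 rfl

lemma IsNilpotent.rad_carrier_succ (hM : M.IsNilpotent) (U : SubRep M) (i : ZMod n) :
    U.rad.carrier (i + 1) = (U.carrier i).map (M.map i) := by
  apply le_antisymm
  · intro v hv
    by_contra hv'
    obtain ⟨X, hX, hvX⟩ := U.exists_covBy_notMem hv.1 hv'
    have := hv.2
    simp only [SetLike.mem_coe, Submodule.mem_iInf] at this
    exact hvX (this X hX)
  · rintro _ ⟨x, hx, rfl⟩
    refine ⟨U.map_mem i x hx, ?_⟩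
    simp only [SetLike.mem_coe, Submodule.mem_iInf]
    exact fun X hX => hM.image_le_of_covBy hX _ (U.map_mem_image hx)

lemma single_apply_mem_range_arrowSum_pow (m : ℕ) {x : ∀ i, M.V i}
    (hx : x ∈ LinearMap.range (M.arrowSum ^ m)) (i : ZMod n) :
    Pi.single i (x i) ∈ LinearMap.range (M.arrowSum ^ m) := by
  induction m generalizing x i with
  | zero => exact ⟨_, rfl⟩
  | succ m ih =>
    obtain ⟨y, rfl⟩ := hx
    obtain ⟨k, rfl⟩ := exists_eq_add_one i
    rw [pow_succ', Module.End.mul_apply, arrowSum_apply_succ, ← arrowSum_single]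
    obtain ⟨z, hz⟩ := ih ⟨y, rfl⟩ k
    exact ⟨z, by rw [Module.End.mul_apply, hz]⟩

/-- Turns membership in a radical power into the existence of a preimage under Tᵐ; the range of Tᵐ
is graded, so components may be taken. -/
lemma IsNilpotent.mem_radPow (hM : M.IsNilpotent) (m : ℕ) {i : ZMod n} {v : M.V i} :
    v ∈ (M.radPow m).carrier i ↔ Pi.single i v ∈ LinearMap.range (M.arrowSum ^ m) := by
  induction m generalizing i with
  | zero => exact ⟨fun _ => ⟨_, rfl⟩, fun _ => trivial⟩
  | succ m ih =>
    obtain ⟨k, rfl⟩ := exists_eq_add_one i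
    rw [radPow, hM.rad_carrier_succ]
    constructor
    · rintro ⟨x, hx, rfl⟩
      obtain ⟨y, hy⟩ := ih.1 hx
      exact ⟨y, by rw [pow_succ', Module.End.mul_apply, hy, arrowSum_single]⟩
    · rintro ⟨y, hy⟩
      refine ⟨(M.arrowSum ^ m) y k, ih.2 (single_apply_mem_range_arrowSum_pow m ⟨y, rfl⟩ k), ?_⟩
      rw [← arrowSum_apply_succ, ← Module.End.mul_apply, ← pow_succ', hy, Pi.single_eq_same]

end CycleRep

/-! ### The linear family of automorphisms moving the stratum -/

namespace CycleRep

variable {K : Type u} [Field K] {n : ℕ} [NeZero n] {M : CycleRep.{u, v} K n}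

/-- A linear family of endomorphisms `Φ x` of `M`, invertible and with `Φ x u₀ = x` for all `x`
in a subset `B \ A` of the socle that lies in a single layer of the radical filtration. -/
lemma IsNilpotent.exists_linear_family (hM : M.IsNilpotent) {i₀ : ZMod n} {u₀ : M.V i₀}
    {A B : Submodule K (M.V i₀)} (hAB : A ≤ B) (hBA : ∀ x ∈ B, ∃ c : K, x - c • u₀ ∈ A)
    (hu₀ : u₀ ∈ B) (hu₀A : u₀ ∉ A) (hB : B ≤ LinearMap.ker (M.map i₀))
    (hrad : ∀ m, u₀ ∈ (M.radPow m).carrier i₀ → B ≤ (M.radPow m).carrier i₀)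
    (hrad' : ∀ m, u₀ ∉ (M.radPow m).carrier i₀ → u₀ ∉ A ⊔ (M.radPow m).carrier i₀) :
    ∃ Φ : ∀ j, M.V i₀ →ₗ[K] M.V j →ₗ[K] M.V j, ∀ x ∈ B, x ∉ A →
      (∀ j v, Φ (j + 1) x (M.map j v) = M.map j (Φ j x v)) ∧
        (∀ j, Function.Injective (Φ j x)) ∧ Φ i₀ x u₀ = x := by
  classical
  have hu₀0 : u₀ ≠ 0 := fun h => hu₀A (h ▸ A.zero_mem)
  have hex : ∃ m, u₀ ∉ (M.radPow m).carrier i₀ := by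
    obtain ⟨N, hN⟩ := hM.exists_arrowSum_pow_eq_zero
    refine ⟨N, fun h => ?_⟩
    obtain ⟨y, hy⟩ := (hM.mem_radPow N).1 h
    rw [hN, LinearMap.zero_apply] at hy
    exact hu₀0 (Pi.single_eq_zero_iff.1 hy.symm)
  -- m is the radical layer of u₀: u₀ lies in radᵐ but not in radᵐ⁺¹.
  obtain ⟨m, hm⟩ : ∃ m, Nat.find hex = m + 1 := by
    refine Nat.exists_eq_succ_of_ne_zero fun h => ?_
    have := Nat.find_spec hex
    rw [h] at this
    exact this trivial
  have hmem : u₀ ∈ (M.radPow m).carrier i₀ := by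
    by_contra h
    have := Nat.find_min' hex h
    omega
  have hnot : u₀ ∉ (M.radPow (m + 1)).carrier i₀ := hm ▸ Nat.find_spec hex
  have hBm := hrad m hmem
  obtain ⟨lam, hlam1, hlamA, hlamR⟩ : ∃ lam : M.V i₀ →ₗ[K] K, lam u₀ = 1 ∧
      (∀ a ∈ A, lam a = 0) ∧ ∀ a ∈ (M.radPow (m + 1)).carrier i₀, lam a = 0 := by
    obtain ⟨l, hlu, hl⟩ := Submodule.exists_le_ker_of_notMem (hrad' _ hnot)
    refine ⟨(l u₀)⁻¹ • l, by simp [hlu], fun a ha => ?_, fun a ha => ?_⟩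
    · simp [LinearMap.mem_ker.1 (hl (Submodule.mem_sup_left ha))]
    · simp [LinearMap.mem_ker.1 (hl (Submodule.mem_sup_right ha))]
  set T := M.arrowSum with hT
  -- Choosing preimages under Tᵐ linearly keeps z, and so Φ, linear in x.
  obtain ⟨s, hs⟩ := (T ^ m).exists_section_on_range
  -- the projection to `A` along `u₀`, on `B`
  let pr : M.V i₀ →ₗ[K] M.V i₀ := LinearMap.id - lam.smulRight u₀
  have hpr : ∀ x ∈ B, pr x ∈ A := by
    intro x hx
    obtain ⟨c, hc⟩ := hBA x hx
    have h := hlamA _ hc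
    rw [map_sub, map_smul, hlam1, smul_eq_mul, mul_one, sub_eq_zero] at h
    simpa [pr, h] using hc
  let z : M.V i₀ →ₗ[K] ∀ i, M.V i := s ∘ₗ LinearMap.single K M.V i₀ ∘ₗ pr
  have hz : ∀ x ∈ B, (T ^ m) (z x) = Pi.single i₀ (pr x) := fun x hx =>
    hs _ ((hM.mem_radPow m).1 (hBm (hAB (hpr x hx))))
  have hz' : ∀ x ∈ B, (T ^ (m + 1)) (z x) = 0 := by
    intro x hx
    rw [pow_succ', Module.End.mul_apply, hz x hx, hT, arrowSum_single,
      LinearMap.mem_ker.1 (hB (hAB (hpr x hx))), Pi.single_zero]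
  -- the nilpotent part, on the total space
  let phi (x : M.V i₀) (v : ∀ i, M.V i) : ∀ i, M.V i :=
    ∑ k ∈ Finset.range (m + 1), lam ((T ^ k) v i₀) • (T ^ (m - k)) (z x)
  -- The difference telescopes. One boundary term vanishes since λ kills radᵐ⁺¹, the other since
  -- Tᵐ⁺¹z = T(pr x) = 0.
  have hphiT : ∀ x ∈ B, ∀ v, phi x (T v) = T (phi x v) := by
    intro x hx v
    have h1 : phi x (T v) =
        ∑ k ∈ Finset.range (m + 1), lam ((T ^ (k + 1)) v i₀) • (T ^ (m + 1 - (k + 1))) (z x) := by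
      refine Finset.sum_congr rfl fun k _ => ?_
      rw [pow_succ, Module.End.mul_apply, Nat.add_sub_add_right]
    have h2 : T (phi x v) =
        ∑ k ∈ Finset.range (m + 1), lam ((T ^ k) v i₀) • (T ^ (m + 1 - k)) (z x) := by
      rw [map_sum]
      refine Finset.sum_congr rfl fun k hk => ?_
      rw [map_smul, ← Module.End.mul_apply, ← pow_succ',
        Nat.sub_add_comm (Nat.lt_succ_iff.1 (Finset.mem_range.1 hk))]
    rw [h1, h2, ← sub_eq_zero, ← Finset.sum_sub_distrib,
      Finset.sum_range_sub fun k => lam ((T ^ k) v i₀) • (T ^ (m + 1 - k)) (z x)]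
    have h3 : lam ((T ^ (m + 1)) v i₀) = 0 :=
      hlamR _ ((hM.mem_radPow _).2 (single_apply_mem_range_arrowSum_pow _ ⟨v, rfl⟩ _))
    rw [h3, zero_smul, Nat.sub_zero, hz' x hx, smul_zero, sub_zero]
  -- If the arrow kills v, only the term k = 0 survives.
  have hphiker : ∀ x ∈ B, ∀ i, ∀ v : M.V i, M.map i v = 0 →
      phi x (Pi.single i v) = lam ((Pi.single i v : ∀ i, M.V i) i₀) • Pi.single i₀ (pr x) := by
    intro x hx i v hv
    have h1 : ∀ k, (T ^ (k + 1)) (Pi.single i v) = 0 := by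
      intro k
      rw [pow_succ, Module.End.mul_apply, hT, arrowSum_single, hv, Pi.single_zero, map_zero]
    simp only [phi]
    rw [Finset.sum_range_succ']
    simp only [h1, Pi.zero_apply, map_zero, zero_smul, Finset.sum_const_zero, zero_add,
      Nat.sub_zero, pow_zero, Module.End.one_apply, hz x hx]
  -- The component at j of λ(x)·id + phi x, assembled from linear maps so that linearity in x and v
  -- is built in.
  let Φ (j : ZMod n) : M.V i₀ →ₗ[K] M.V j →ₗ[K] M.V j :=
    lam.smulRight LinearMap.id + ∑ k ∈ Finset.range (m + 1),
      (LinearMap.smulRightₗ (lam ∘ₗ LinearMap.proj i₀ ∘ₗ (T ^ k) ∘ₗ LinearMap.single K M.V j)) ∘ₗ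
        LinearMap.proj j ∘ₗ (T ^ (m - k)) ∘ₗ z
  have hΦ : ∀ j x v, Φ j x v = lam x • v + phi x (Pi.single j v) j := by
    intro j x v
    simp [Φ, phi, LinearMap.sum_apply, Finset.sum_apply]
  refine ⟨Φ, fun x hx hxA => ?_⟩
  have hcomm : ∀ j v, Φ (j + 1) x (M.map j v) = M.map j (Φ j x v) := by
    intro j v
    rw [hΦ, hΦ, ← arrowSum_single, hphiT x hx, hT, arrowSum_apply_succ, map_add, map_smul]
  have hlamx : lam x ≠ 0 := by
    intro h
    have := hpr x hx
    simp only [pr, LinearMap.sub_apply, LinearMap.id_apply, LinearMap.smulRight_apply, h,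
      zero_smul, sub_zero] at this
    exact hxA this
  refine ⟨hcomm, fun j => ?_, ?_⟩
  -- A nonzero kernel would contain some v ≠ 0 killed by its arrow. Away from i₀ this says λ(x)v =
  -- 0; at i₀ it says λ(x)v + λ(v) pr x = 0, and applying λ gives λ(v) = 0. Either way v = 0.
  · let X : SubRep M := ⟨fun j => LinearMap.ker (Φ j x), fun j v hv => by
      rw [LinearMap.mem_ker, hcomm, LinearMap.mem_ker.1 hv, map_zero]⟩
    have hX : X = ⊥ := by
      by_contra hne
      obtain ⟨i, v, hv, hv0, hk⟩ := hM.exists_mem_ker hne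
      have hv : Φ i x v = 0 := hv
      rw [hΦ, hphiker x hx i v hk] at hv
      by_cases h : i = i₀
      · subst h
        simp only [Pi.single_eq_same, Pi.smul_apply] at hv
        have h1 := congrArg lam hv
        rw [map_add, map_smul, map_smul, hlamA _ (hpr x hx), smul_zero, add_zero, map_zero,
          smul_eq_mul] at h1
        have h2 : lam v = 0 := (mul_eq_zero.1 h1).resolve_left hlamx
        rw [h2, zero_smul, add_zero] at hv
        exact hv0 ((smul_eq_zero.1 hv).resolve_left hlamx)
      · rw [Pi.smul_apply, Pi.single_eq_of_ne h, smul_zero, add_zero] at hv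
        exact hv0 ((smul_eq_zero.1 hv).resolve_left hlamx)
    exact LinearMap.ker_eq_bot.1 (congrFun (congrArg SubRep.carrier hX) j)
  · rw [hΦ, hphiker x hx i₀ u₀ (hB hu₀)]
    simp [hlam1, pr]

omit [NeZero n] in
lemma SocleFlag.last_eq (W : M.SocleFlag) (i : ZMod n) : W.W i (Fin.last _) = M.soc i :=
  Submodule.eq_of_le_of_finrank_eq (W.le_soc i _) (by rw [W.finrank_eq]; rfl)

/-- The stratum is an orbit, transitively moved by a linear family of automorphisms of `M`. -/
lemma IsNilpotent.exists_stratum_family (hM : M.IsNilpotent) {e : ZMod n → ℕ}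
    (he : ∑ i, e i = 1) (W : M.SocleFlag) (w : ∀ i, Fin (finrank K (M.soc i) + 1) → ℕ)
    (U₀ : Gr M e) (hU₀ : U₀ ∈ grStratum M e W w) :
    ∃ i₀, e i₀ = 1 ∧ ∃ Φ : ∀ j, M.V i₀ →ₗ[K] M.V j →ₗ[K] M.V j,
      ∀ L ∈ grStratum M e W w, ∀ x ∈ L.1.carrier i₀, x ≠ 0 →
        (∀ j v, Φ (j + 1) x (M.map j v) = M.map j (Φ j x v)) ∧
          (∀ j, Function.Injective (Φ j x)) ∧
          ∀ j, (U₀.1.carrier j).map (Φ j x) = L.1.carrier j := by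
  obtain ⟨i₀, hi₀⟩ : ∃ i₀, e i₀ ≠ 0 := by
    by_contra! h
    simp [h] at he
  have hsum := Finset.add_sum_erase Finset.univ e (Finset.mem_univ i₀)
  have hi₀1 : e i₀ = 1 := by omega
  have hne : ∀ j, j ≠ i₀ → e j = 0 := by
    intro j hj
    have h0 : ∑ i ∈ Finset.univ.erase i₀, e i = 0 := by omega
    exact Finset.sum_eq_zero_iff.1 h0 j (by simp [hj])
  have hfin : ∀ L : Gr M e, finrank K (L.1.carrier i₀) = 1 := fun L =>
    (congrFun L.2 i₀).trans hi₀1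
  have hspan : ∀ L : Gr M e, ∀ x ∈ L.1.carrier i₀, x ≠ 0 → L.1.carrier i₀ = K ∙ x := by
    intro L x hx hx0
    symm
    refine Submodule.eq_of_le_of_finrank_eq ((Submodule.span_singleton_le_iff_mem _ _).2 hx) ?_
    rw [finrank_span_singleton hx0, hfin L]
  -- Membership in each flag step depends on w alone, so it is the same for all lines of the
  -- stratum.
  have hmemW : ∀ L ∈ grStratum M e W w, ∀ x ∈ L.1.carrier i₀, x ≠ 0 → ∀ l,
      (x ∈ W.W i₀ l ↔ w i₀ l = 1) := by
    intro L hL x hx hx0 l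
    rw [← hL i₀ l]
    constructor
    · intro h
      rw [inf_eq_left.2, hfin L]
      rw [hspan L x hx hx0, Submodule.span_singleton_le_iff_mem]
      exact h
    · intro h
      have : L.1.carrier i₀ ⊓ W.W i₀ l = L.1.carrier i₀ :=
        Submodule.eq_of_le_of_finrank_eq inf_le_left (h.trans (hfin L).symm)
      exact (inf_eq_left.1 this) hx
  obtain ⟨u₀', hu₀', -⟩ := finrank_eq_one_iff'.1 (hfin U₀)
  obtain ⟨u₀, hu₀⟩ := u₀'
  have hu₀0 : u₀ ≠ 0 := fun h => hu₀' (Subtype.ext h)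
  have hsoc : u₀ ∈ M.soc i₀ := by
    refine SubRep.le_soc (L := U₀.1) ?_ i₀ hu₀
    rw [U₀.2, he]
  have hexl : ∃ l : ℕ, ∃ h : l < finrank K (M.soc i₀) + 1, u₀ ∈ W.W i₀ ⟨l, h⟩ :=
    ⟨_, Nat.lt_succ_self _, by
      have := W.last_eq i₀
      rw [Fin.last] at this
      rw [this]
      exact hsoc⟩
  classical
  obtain ⟨hl, hul⟩ := Nat.find_spec hexl
  -- The least flag step containing u₀ is not the zero step; it becomes B, and its predecessor A.
  obtain ⟨l, hl'⟩ : ∃ l, Nat.find hexl = l + 1 := by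
    refine Nat.exists_eq_succ_of_ne_zero fun h => ?_
    have h1 : W.W i₀ ⟨_, hl⟩ = ⊥ := Submodule.finrank_eq_zero.1 ((W.finrank_eq _ _).trans h)
    rw [h1] at hul
    exact hu₀0 hul
  have hmin : ∀ k (h : k < finrank K (M.soc i₀) + 1), u₀ ∈ W.W i₀ ⟨k, h⟩ → l + 1 ≤ k :=
    fun k h hk => hl' ▸ Nat.find_min' hexl ⟨h, hk⟩
  simp only [hl'] at hl hul
  set B := W.W i₀ ⟨l + 1, hl⟩ with hB
  set A := W.W i₀ ⟨l, by omega⟩ with hA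
  have huA : u₀ ∉ A := fun h => by have := hmin _ _ h; omega
  have hAB : A ≤ B := W.monotone i₀ (by simp)
  have hABsup : A ⊔ (K ∙ u₀) = B := by
    refine Submodule.eq_of_le_of_finrank_le
      (sup_le hAB ((Submodule.span_singleton_le_iff_mem _ _).2 hul)) ?_
    rw [hB, W.finrank_eq]
    have h1 : A < A ⊔ (K ∙ u₀) := lt_of_le_of_ne le_sup_left fun h =>
      huA (h ▸ Submodule.mem_sup_right (Submodule.mem_span_singleton_self u₀))
    have h2 := Submodule.finrank_lt_finrank_of_lt h1
    have h3 : finrank K A = l := W.finrank_eq i₀ _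
    change l + 1 ≤ _
    omega
  obtain ⟨Φ, hΦ⟩ := hM.exists_linear_family (u₀ := u₀) (A := A) (B := B) hAB
    (fun x hx => by
      rw [← hABsup] at hx
      obtain ⟨a, ha, b, hb, rfl⟩ := Submodule.mem_sup.1 hx
      obtain ⟨c, rfl⟩ := Submodule.mem_span_singleton.1 hb
      exact ⟨c, by simpa using ha⟩)
    hul huA ((W.le_soc _ _).trans (hM.soc_le_ker i₀))
    -- soc ∩ radᵐ is a flag step containing u₀, hence contains B.
    (fun m hm => by
      obtain ⟨k, hk⟩ := W.refines i₀ m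
      have h1 : u₀ ∈ W.W i₀ k := hk ▸ ⟨hsoc, hm⟩
      have h2 : B ≤ W.W i₀ k := W.monotone i₀ (Fin.mk_le_of_le_val (hmin k.1 k.2 h1))
      exact h2.trans (hk ▸ inf_le_right))
    -- If u₀ = a + b, then b lies in soc ∩ radᵐ, a flag step without u₀ and so contained in A; this
    -- would put u₀ in A.
    (fun m hm h => by
      obtain ⟨k, hk⟩ := W.refines i₀ m
      obtain ⟨a, ha, b, hb, hab⟩ := Submodule.mem_sup.1 h
      have hb' : b ∈ W.W i₀ k := by
        rw [hk]
        refine ⟨?_, hb⟩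
        rw [← eq_sub_iff_add_eq'] at hab
        rw [hab]
        exact Submodule.sub_mem _ hsoc (W.le_soc _ _ ha)
      have hkA : W.W i₀ k ≤ A := by
        refine W.monotone i₀ ?_
        by_contra hlt
        refine hm ?_
        have h2 : B ≤ W.W i₀ k := W.monotone i₀ (by
          rw [Fin.le_def]
          simp only [Fin.le_def] at hlt
          change l + 1 ≤ k.1
          omega)
        have h3 := h2 hul
        rw [hk] at h3
        exact h3.2
      exact huA (hab ▸ A.add_mem ha (hkA hb')))
  refine ⟨i₀, hi₀1, Φ, fun L hL x hx hx0 => ?_⟩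
  have hmem : ∀ k, x ∈ W.W i₀ k ↔ u₀ ∈ W.W i₀ k := fun k => by
    rw [hmemW L hL x hx hx0, hmemW U₀ hU₀ u₀ hu₀ hu₀0]
  obtain ⟨h1, h2, h3⟩ := hΦ x ((hmem _).2 hul) (fun h => huA ((hmem _).1 h))
  refine ⟨h1, h2, fun j => ?_⟩
  by_cases hj : j = i₀
  · subst hj
    rw [hspan U₀ u₀ hu₀ hu₀0, Submodule.map_span, Set.image_singleton, h3, hspan L x hx hx0]
  · rw [Submodule.finrank_eq_zero.1 ((congrFun U₀.2 j).trans (hne j hj)),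
      Submodule.finrank_eq_zero.1 ((congrFun L.2 j).trans (hne j hj)), Submodule.map_bot]

end CycleRep

/-! ### Maps given by global forms -/

namespace MultiprojectiveSet

variable {K : Type u} [Field K]

variable {X : Type v} (A : MultiprojectiveSet.{u, v, w} K X)

/-- Maps to a vector space given globally by forms in the homogeneous coordinates. -/
def IsHomogeneousMap {V : Type*} [AddCommGroup V] [Module K V] (P : X → V) : Prop :=
  ∃ (δ : A.J → ℕ) (F : (∀ i, A.W i) → V), IsForm (K := K) δ F ∧ ∀ x, F (A.coord x) = P x

lemma isHomogeneousMap_coord (j : A.J) : A.IsHomogeneousMap fun x => (A.point x j).rep := by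
  classical
  exact ⟨_, _, IsForm.proj j, fun _ => rfl⟩

namespace IsHomogeneousMap

variable {A} {V V' : Type*} [AddCommGroup V] [Module K V] [AddCommGroup V'] [Module K V']

lemma const (v : V) : A.IsHomogeneousMap fun _ => v :=
  ⟨0, fun _ => v, ⟨fun _ => IsPolynomialFunction.const _, by simp⟩, fun _ => rfl⟩

lemma comp {P : X → V} (hP : A.IsHomogeneousMap P) (L : V →ₗ[K] V') :
    A.IsHomogeneousMap fun x => L (P x) := by
  obtain ⟨δ, F, hF, h⟩ := hP
  exact ⟨δ, _, hF.comp L, fun x => congrArg L (h x)⟩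

lemma exteriorMap [FiniteDimensional K V] [FiniteDimensional K V'] {k : ℕ} {P : X → V →ₗ[K] V'}
    {p : X → ⋀[K]^k V} (hP : A.IsHomogeneousMap P) (hp : A.IsHomogeneousMap p) :
    A.IsHomogeneousMap fun x => exteriorPower.map k (P x) (p x) := by
  obtain ⟨δ, F, hF, h⟩ := hP
  obtain ⟨ε, G, hG, h'⟩ := hp
  exact ⟨_, _, hF.exteriorMap hG, fun x => by rw [h, h']⟩

lemma adjugate [FiniteDimensional K V] {P : X → V →ₗ[K] V} (hP : A.IsHomogeneousMap P) :
    A.IsHomogeneousMap fun x => (P x).adjugate := by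
  obtain ⟨δ, F, hF, h⟩ := hP
  exact ⟨_, _, hF.adjugate, fun x => by rw [h]⟩

end IsHomogeneousMap

/-- A form without zeros on all of X needs no covering: the denominator 1 works at every point. -/
lemma isRegularMap_of_isHomogeneousMap {Y : Type w'} {A : MultiprojectiveSet.{u, v, w} K X}
    {B : MultiprojectiveSet.{u, w', w} K Y} {φ : X → Y}
    (h : ∀ j : B.J, ∃ P : X → B.W j, A.IsHomogeneousMap P ∧
      ∀ x : X, ∃ h : P x ≠ 0, B.point (φ x) j = Projectivization.mk K _ h) :
    A.IsRegularMap B φ := by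
  intro x j
  obtain ⟨P, ⟨δ, F, hF, hFP⟩, hP⟩ := h j
  refine ⟨0, δ, fun _ => 1, F, ⟨fun _ => IsPolynomialFunction.const _, by simp⟩, hF, one_ne_zero,
    fun y _ => ?_⟩
  rw [hFP]
  exact hP y

end MultiprojectiveSet

/-! ### Families of quotient maps and the bijection on flags -/

namespace CycleRep

variable {K : Type u} [Field K] {n : ℕ} {M N : CycleRep.{u, v} K n}

lemma isoClass_quot_eq {U : SubRep M} (q : ∀ j, M.V j →ₗ[K] N.V j)
    (hq : ∀ j x, q (j + 1) (M.map j x) = N.map j (q j x))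
    (hsurj : ∀ j, Function.Surjective (q j)) (hker : ∀ j, LinearMap.ker (q j) = U.carrier j) :
    U.quot.isoClass = N.isoClass := by
  refine Quotient.sound ⟨fun j => (Submodule.quotEquivOfEq _ _ (hker j).symm).trans
    ((q j).quotKerEquivOfSurjective (hsurj j)), fun j x => ?_⟩
  obtain ⟨x, rfl⟩ := Submodule.Quotient.mk_surjective _ x
  exact hq j x

/-- A family of quotient maps `M → N` with kernels the members of `S`. -/
structure QuotientFamily {e : ZMod n → ℕ} (S : Set (Gr M e)) (N : CycleRep.{u, v} K n) where
  q : S → ∀ j, M.V j →ₗ[K] N.V j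
  comm : ∀ L j x, q L (j + 1) (M.map j x) = N.map j (q L j x)
  surjective : ∀ L j, Function.Surjective (q L j)
  ker : ∀ L j, LinearMap.ker (q L j) = L.1.1.carrier j

namespace QuotientFamily

variable {e : ZMod n → ℕ} {S : Set (Gr M e)}

/-- The image of a subrepresentation of `M` in `N`. -/
def map (Q : QuotientFamily S N) (L : S) (U : SubRep M) : SubRep N where
  carrier j := (U.carrier j).map (Q.q L j)
  map_mem j y hy := by
    obtain ⟨x, hx, rfl⟩ := hy
    exact ⟨M.map j x, U.map_mem j x hx, Q.comm L j x⟩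

/-- The preimage of a subrepresentation of `N` in `M`. -/
def comap (Q : QuotientFamily S N) (L : S) (V : SubRep N) : SubRep M where
  carrier j := (V.carrier j).comap (Q.q L j)
  map_mem j x hx := by
    rw [Submodule.mem_comap, Q.comm]
    exact V.map_mem j _ hx

lemma map_comap (Q : QuotientFamily S N) (L : S) (V : SubRep N) : Q.map L (Q.comap L V) = V :=
  SubRep.ext (funext fun j => Submodule.map_comap_eq_of_surjective (Q.surjective L j) _)

lemma comap_map (Q : QuotientFamily S N) {L : S} {U : SubRep M} (h : L.1.1 ≤ U) :
    Q.comap L (Q.map L U) = U :=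
  SubRep.ext (funext fun j => by
    change ((U.carrier j).map _).comap _ = _
    rw [Submodule.comap_map_eq, Q.ker, sup_eq_left.2 (h j)])

lemma comap_bot (Q : QuotientFamily S N) (L : S) : Q.comap L ⊥ = L.1.1 :=
  SubRep.ext (funext fun j => Q.ker L j)

lemma finrank_comap (Q : QuotientFamily S N) (L : S) (V : SubRep N) (j : ZMod n) :
    (Q.comap L V).dimVec j = V.dimVec j + e j := by
  rw [SubRep.dimVec, comap, Submodule.finrank_comap_of_surjective (Q.surjective L j), Q.ker]
  congr 1
  exact congrFun L.1.2 j

lemma isoClass_quot_self (Q : QuotientFamily S N) (L : S) : L.1.1.quot.isoClass = N.isoClass :=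
  isoClass_quot_eq (Q.q L) (Q.comm L) (Q.surjective L) (Q.ker L)

lemma isoClass_quot_comap (Q : QuotientFamily S N) (L : S) (V : SubRep N) :
    (Q.comap L V).quot.isoClass = V.quot.isoClass :=
  isoClass_quot_eq (N := V.quot) (fun j => (V.carrier j).mkQ ∘ₗ Q.q L j)
    (fun j x => congrArg (V.carrier (j + 1)).mkQ (Q.comm L j x))
    (fun j => (V.carrier j).mkQ_surjective.comp (Q.surjective L j))
    (fun j => by
      erw [LinearMap.ker_comp, Submodule.ker_mkQ]
      rfl)

end QuotientFamily

lemma Fl.apply_eq_bot {r : ℕ} {d : Fin (r + 1) → ZMod n → ℕ} (U : Fl M d) {k : Fin (r + 1)}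
    (h : ∀ j, d k j = 0) : U.U k = ⊥ :=
  SubRep.ext (funext fun j => Submodule.finrank_eq_zero.1 ((congrFun (U.dim k) j).trans (h j)))

variable {r : ℕ} {d : Fin (r + 2) → ZMod n → ℕ} {S : Set (Gr M (d 1))}

lemma Fl.one_le_succ (U : Fl M d) (k : Fin (r + 1)) : U.U 1 ≤ U.U k.succ :=
  U.monotone (by
    rw [← Fin.succ_zero_eq_one]
    exact Fin.succ_le_succ_iff.2 (Fin.zero_le k))

namespace QuotientFamily

lemma map_dimVec (Q : QuotientFamily S N) (L : S) {U : SubRep M} (h : L.1.1 ≤ U) (j : ZMod n) :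
    (Q.map L U).dimVec j = U.dimVec j - d 1 j := by
  have := Q.finrank_comap L (Q.map L U) j
  rw [Q.comap_map h] at this
  omega

/-- The flag in `N` induced by a flag in `M`. -/
def mapFl (Q : QuotientFamily S N) (U : (forget ⁻¹' S : Set (Fl M d))) :
    Fl N fun (k : Fin (r + 1)) i => d k.succ i - d 1 i where
  U k := Q.map ⟨forget U.1, U.2⟩ (U.1.U k.succ)
  monotone k l hkl j := Submodule.map_mono (U.1.monotone (Fin.succ_le_succ_iff.2 hkl) j)
  last := SubRep.ext (funext fun j => by
    rw [Fin.succ_last, U.1.last]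
    change (⊤ : Submodule K (M.V j)).map _ = ⊤
    rw [Submodule.map_top, LinearMap.range_eq_top]
    exact Q.surjective _ j)
  dim k := funext fun j => by
    rw [Q.map_dimVec _ (U.1.one_le_succ k), U.1.dim]

variable [NeZero n]

/-- The flag in `M` induced by a flag in `N`. -/
def comapFl (hd : IsCompleteDimFiltration d) (Q : QuotientFamily S N) (L : S)
    (V : Fl N fun (k : Fin (r + 1)) i => d k.succ i - d 1 i) : Fl M d where
  -- The flag in N starts with the image of U¹, so U⁰ = 0 has to be put back.
  U := Fin.cons ⊥ fun k => Q.comap L (V.U k)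
  monotone k l hkl := by
    refine Fin.cases (fun _ => bot_le) (fun k => ?_) k hkl
    refine Fin.cases (fun h => absurd h (by simp)) (fun l => ?_) l
    exact fun h j => Submodule.comap_mono (V.monotone (Fin.succ_le_succ_iff.1 h) j)
  last := SubRep.ext (funext fun j => by
    rw [← Fin.succ_last, Fin.cons_succ, V.last]
    rfl)
  dim k := by
    refine Fin.cases ?_ (fun k => ?_) k
    · rw [Fin.cons_zero, hd.zero]
      exact funext fun j => finrank_bot K (M.V j)
    · rw [Fin.cons_succ]
      funext j
      rw [Q.finrank_comap, V.dim]
      refine Nat.sub_add_cancel (hd.monotone ?_ j)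
      rw [← Fin.succ_zero_eq_one]
      exact Fin.succ_le_succ_iff.2 (Fin.zero_le k)

/-- V⁰ has dimension vector d¹ - d¹ = 0, and the preimage of 0 is the kernel L. -/
lemma forget_comapFl (hd : IsCompleteDimFiltration d) (Q : QuotientFamily S N) (L : S)
    (V : Fl N fun (k : Fin (r + 1)) i => d k.succ i - d 1 i) :
    forget (Q.comapFl hd L V) = L.1 := by
  refine Subtype.ext ?_
  refine (congrArg (Q.comapFl hd L V).U Fin.succ_zero_eq_one.symm).trans ?_
  change Q.comap L (V.U 0) = L.1.1
  rw [V.apply_eq_bot (k := 0) fun j => by simp, Q.comap_bot]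

/-- Flags in `M` starting with a member of `S` are pairs of a member of `S` and a flag in `N`. -/
def flEquiv (hd : IsCompleteDimFiltration d) (Q : QuotientFamily S N) :
    (forget ⁻¹' S : Set (Fl M d)) ≃ S × Fl N fun (k : Fin (r + 1)) i => d k.succ i - d 1 i where
  toFun U := (⟨forget U.1, U.2⟩, Q.mapFl U)
  invFun p := ⟨Q.comapFl hd p.1 p.2, by
    rw [Set.mem_preimage, forget_comapFl]
    exact p.1.2⟩
  left_inv U := by
    refine Subtype.ext (Fl.ext (funext fun k => ?_))
    refine Fin.cases ?_ (fun k => ?_) k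
    · exact (U.1.apply_eq_bot fun j => by rw [hd.zero]; rfl).symm
    · exact Q.comap_map (U.1.one_le_succ k)
  right_inv p := by
    have h (hL) : (⟨forget (Q.comapFl hd p.1 p.2), hL⟩ : S) = p.1 :=
      Subtype.ext (Q.forget_comapFl hd p.1 p.2)
    refine Prod.ext (h _) (Fl.ext (funext fun k => ?_))
    change Q.map ⟨forget (Q.comapFl hd p.1 p.2), _⟩ (Q.comap p.1 (p.2.U k)) = p.2.U k
    rw [h, Q.map_comap]

lemma sp_flEquiv (hd : IsCompleteDimFiltration d) (Q : QuotientFamily S N)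
    (U : (forget ⁻¹' S : Set (Fl M d))) :
    sp U.1 = Fin.cons N.isoClass (sp (Q.flEquiv hd U).2) := by
  funext k
  refine Fin.cases ?_ (fun k => ?_) k
  · exact Q.isoClass_quot_self ⟨forget U.1, U.2⟩
  · rw [Fin.cons_succ]
    have h := Q.isoClass_quot_comap ⟨forget U.1, U.2⟩ ((Q.mapFl U).U k.succ)
    refine Eq.trans ?_ h
    have h' : Q.comap ⟨forget U.1, U.2⟩ ((Q.mapFl U).U k.succ) = U.1.U k.succ.succ :=
      Q.comap_map (U.1.one_le_succ k.succ)
    rw [h']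
    rfl

end QuotientFamily

end CycleRep

/-! ### The isomorphism and its regularity -/

theorem mainTheorem2 {K : Type u} [Field K] [IsAlgClosed K] {n : ℕ} [NeZero n]
    (M : CycleRep.{u, v} K n) (hM : M.IsNilpotent)
    {r : ℕ} (d : Fin (r + 2) → ZMod n → ℕ)
    (hd : CycleRep.IsCompleteDimFiltration d) (hdM : d (Fin.last (r + 1)) = M.dimVec)
    (W : M.SocleFlag) (w : ∀ i, Fin (Module.finrank K (M.soc i) + 1) → ℕ)
    (U₀ : CycleRep.Gr M (d 1)) (hU₀ : U₀ ∈ CycleRep.grStratum M (d 1) W w) :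
    ∃ f : (CycleRep.forget ⁻¹' CycleRep.grStratum M (d 1) W w : Set (CycleRep.Fl M d)) ≃
        CycleRep.grStratum M (d 1) W w ×
          CycleRep.Fl U₀.1.quot (fun (k : Fin (r + 1)) i => d k.succ i - d 1 i),
      MultiprojectiveSet.IsIsomorphism
          ((M.flVariety d).restrict (CycleRep.forget ⁻¹' CycleRep.grStratum M (d 1) W w))
          (((M.grVariety (d 1)).restrict (CycleRep.grStratum M (d 1) W w)).prod
            (U₀.1.quot.flVariety fun (k : Fin (r + 1)) i => d k.succ i - d 1 i)) f ∧
        (∀ U, ((f U).1 : CycleRep.Gr M (d 1)) = CycleRep.forget U.1) ∧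
        ∀ U, CycleRep.sp U.1 = Fin.cons U₀.1.quot.isoClass (CycleRep.sp (f U).2) := by
  classical
  have he : ∑ i, d 1 i = 1 := by
    have h := hd.step 0
    rw [Fin.succ_zero_eq_one, Fin.castSucc_zero, hd.zero] at h
    simpa using h
  have he1 : ∀ j, d 1 j ≤ 1 := fun j =>
    (Finset.single_le_sum (f := d 1) (fun _ _ => Nat.zero_le _) (Finset.mem_univ j)).trans he.le
  have hadd : ∀ (k : Fin (r + 1)) j, d k.succ j = d k.succ j - d 1 j + d 1 j := fun k j =>
    (Nat.sub_add_cancel (hd.monotone (by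
      rw [← Fin.succ_zero_eq_one]
      exact Fin.succ_le_succ_iff.2 (Fin.zero_le k)) j)).symm
  obtain ⟨i₀, hi₀, Φ, hΦ⟩ := hM.exists_stratum_family he W w U₀ hU₀
  set S := CycleRep.grStratum M (d 1) W w with hS
  obtain ⟨τ, hτ, hτS⟩ := exists_linearMap_plueckerLine_of_eq_one (K := K) (V := M.V i₀) hi₀
  -- A generator of L that is linear in the homogeneous coordinates of L.
  let X (L : CycleRep.Gr M (d 1)) : M.V i₀ :=
    τ (plueckerPoint (L.1.carrier i₀) (congrFun L.2 i₀)).rep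
  have hX : ∀ L, X L ∈ L.1.carrier i₀ := fun L => hτS _ _ (plueckerPoint_rep_mem _)
  have hX0 : ∀ L, X L ≠ 0 := fun L h =>
    Projectivization.rep_nonzero _ ((map_eq_zero_iff τ hτ).1 h)
  have hcomm : ∀ L : S, ∀ j v, Φ (j + 1) (X L) (M.map j v) = M.map j (Φ j (X L) v) := fun L =>
    (hΦ L L.2 _ (hX _) (hX0 _)).1
  have hinj : ∀ L : S, ∀ j, Function.Injective (Φ j (X L)) := fun L =>
    (hΦ L L.2 _ (hX _) (hX0 _)).2.1
  have himg : ∀ L : S, ∀ j, (U₀.1.carrier j).map (Φ j (X L)) = L.1.1.carrier j := fun L =>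
    (hΦ L L.2 _ (hX _) (hX0 _)).2.2
  let g (L : S) (j : ZMod n) : M.V j ≃ₗ[K] M.V j := LinearEquiv.ofInjectiveEndo _ (hinj L j)
  have hg : ∀ L j v, g L j v = Φ j (X L) v := fun L j v => rfl
  -- The inverse of Φ at `X L` carries L to U₀, so following it by the projection gives kernel L.
  let Q : CycleRep.QuotientFamily S U₀.1.quot :=
    { q := fun L j => (U₀.1.carrier j).mkQ ∘ₗ (g L j).symm.toLinearMap
      comm := fun L j x => by
        obtain ⟨y, rfl⟩ := (g L j).surjective x
        have h1 : (g L (j + 1)).symm (M.map j (g L j y)) = M.map j y := by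
          rw [LinearEquiv.symm_apply_eq, hg, hg, hcomm]
        have h2 : (g L j).symm (g L j y) = y := LinearEquiv.symm_apply_apply _ _
        change (U₀.1.carrier (j + 1)).mkQ ((g L (j + 1)).symm _) =
          (U₀.1.carrier (j + 1)).mkQ (M.map j ((g L j).symm (g L j y)))
        rw [h1, h2]
      surjective := fun L j => (U₀.1.carrier j).mkQ_surjective.comp (g L j).symm.surjective
      ker := fun L j => by
        erw [LinearMap.ker_comp, Submodule.ker_mkQ]
        rw [← himg L j]
        exact (Submodule.map_equiv_eq_comap_symm (g L j) _).symm }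
  have hQ : ∀ L j v, Q.q L j (Φ j (X L) v) = (U₀.1.carrier j).mkQ v := fun L j v =>
    congrArg (U₀.1.carrier j).mkQ ((g L j).symm_apply_apply v)
  refine ⟨Q.flEquiv hd, ⟨?_, ?_⟩, fun U => rfl, Q.sp_flEquiv hd⟩
  · set A := (M.flVariety d).restrict (CycleRep.forget ⁻¹' S) with hA
    refine MultiprojectiveSet.isRegularMap_of_isHomogeneousMap ?_
    rintro ((i : ZMod n) | ⟨k, j⟩)
    · let P (U : (CycleRep.forget ⁻¹' S : Set (CycleRep.Fl M d))) :=
        plueckerPoint ((U.1.U 1).carrier i) (congrFun (U.1.dim 1) i)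
      have h1 : A.IsHomogeneousMap fun U => (P U).rep := A.isHomogeneousMap_coord (1, i)
      exact ⟨_, h1, fun U => ⟨(P U).rep_nonzero, (P U).mk_rep.symm⟩⟩
    · obtain ⟨ρ, hρ⟩ := exists_leftInverse_plueckerLine_comap_mkQ (U₀.1.carrier j)
        (congrFun U₀.2 j) (he1 j) (hadd k j)
      have h1 : A.IsHomogeneousMap (V := ⋀[K]^(d 1 i₀) (M.V i₀)) fun U =>
          (plueckerPoint ((U.1.U 1).carrier i₀) (congrFun (U.1.dim 1) i₀)).rep :=
        A.isHomogeneousMap_coord (1, i₀)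
      have h2 : A.IsHomogeneousMap (V := ⋀[K]^(d k.succ j) (M.V j)) fun U =>
          (plueckerPoint ((U.1.U k.succ).carrier j) (congrFun (U.1.dim k.succ) j)).rep :=
        A.isHomogeneousMap_coord (k.succ, j)
      -- The adjugate moves the subspace of M onto the preimage of its image in N, and ρ then
      -- descends to the quotient.
      refine ⟨_, ((h1.comp (Φ j ∘ₗ τ)).adjugate.exteriorMap h2).comp ρ, fun U => ?_⟩
      let L : S := ⟨CycleRep.forget U.1, U.2⟩
      have hdet : LinearMap.det (Φ j (X L)) ≠ 0 := fun h =>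
        (LinearMap.bot_lt_ker_of_det_eq_zero h).ne' (LinearMap.ker_eq_bot.2 (hinj L j))
      have hadj : Function.Injective (Φ j (X L)).adjugate := by
        refine Function.Injective.of_comp (f := Φ j (X L)) fun x y hxy => ?_
        simp only [Function.comp_apply, LinearMap.comp_adjugate] at hxy
        exact smul_right_injective _ hdet hxy
      have hmem := map_mem_plueckerLine (g := (Φ j (X L)).adjugate)
        (S' := (((Q.mapFl U).U k).carrier j).comap (U₀.1.carrier j).mkQ) (fun x hx => by
          change (U₀.1.carrier j).mkQ ((Φ j (X L)).adjugate x) ∈ ((Q.mapFl U).U k).carrier j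
          -- The class of adj(x) modulo U₀ is the image under q of Φ(adj(x)) = det · x.
          rw [← hQ L, LinearMap.comp_adjugate]
          exact ⟨_, Submodule.smul_mem _ _ hx, rfl⟩)
        (plueckerPoint_rep_mem (congrFun (U.1.dim k.succ) j))
      obtain ⟨h3, h4⟩ := hρ _ (congrFun ((Q.mapFl U).dim k) j) _ hmem fun h =>
        Projectivization.rep_nonzero _
          ((map_eq_zero_iff _ (exteriorPower.map_injective_field hadj)).1 h)
      exact ⟨h4, plueckerPoint_eq_mk (congrFun ((Q.mapFl U).dim k) j) h3 h4⟩
  · set A := ((M.grVariety (d 1)).restrict S).prod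
      (U₀.1.quot.flVariety fun (k : Fin (r + 1)) i => d k.succ i - d 1 i) with hA
    refine MultiprojectiveSet.isRegularMap_of_isHomogeneousMap ?_
    rintro ⟨k, j⟩
    refine Fin.cases ?_ (fun k => ?_) k
    · have hbot : finrank K (⊥ : Submodule K (M.V j)) = d 0 j := by
        rw [finrank_bot, hd.zero]
        rfl
      let P := plueckerPoint ⊥ hbot
      exact ⟨_, MultiprojectiveSet.IsHomogeneousMap.const P.rep, fun p =>
        ⟨P.rep_nonzero, P.mk_rep.symm⟩⟩
    · obtain ⟨ω, hω, hωS⟩ := exists_linearMap_plueckerLine_comap_mkQ (U₀.1.carrier j)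
        (congrFun U₀.2 j) (he1 j) (hadd k j)
      have h1 : A.IsHomogeneousMap (V := ⋀[K]^(d 1 i₀) (M.V i₀)) fun p =>
          (plueckerPoint (p.1.1.1.carrier i₀) (congrFun p.1.1.2 i₀)).rep :=
        A.isHomogeneousMap_coord (.inl i₀)
      have h2 : A.IsHomogeneousMap
          (V := ⋀[K]^(d k.succ j - d 1 j) (M.V j ⧸ U₀.1.carrier j)) fun p =>
          (plueckerPoint ((p.2.U k).carrier j) (congrFun (p.2.dim k) j)).rep :=
        A.isHomogeneousMap_coord (.inr (k, j))
      -- Here Φ itself is applied: ω lifts the subspace of N to its preimage containing U₀, which Φ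
      -- carries into the preimage under q.
      refine ⟨_, (h1.comp (Φ j ∘ₗ τ)).exteriorMap (h2.comp ω), fun p => ?_⟩
      have hmem := map_mem_plueckerLine (g := Φ j (X p.1.1))
        (S' := ((Q.comap p.1 (p.2.U k)).carrier j)) (fun x hx => by
          change Q.q p.1 j (Φ j (X p.1.1) x) ∈ (p.2.U k).carrier j
          rw [hQ]
          exact hx)
        (hωS _ _ (plueckerPoint_rep_mem (congrFun (p.2.dim k) j)))
      let P := plueckerPoint ((p.2.U k).carrier j) (congrFun (p.2.dim k) j)
      have h0 : exteriorPower.map _ (Φ j (X p.1.1)) (ω P.rep) ≠ 0 := fun h =>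
        P.rep_nonzero ((map_eq_zero_iff ω hω).1
          ((map_eq_zero_iff _ (exteriorPower.map_injective_field (hinj p.1 j))).1 h))
      exact ⟨h0, plueckerPoint_eq_mk (congrFun ((Q.comapFl hd p.1 p.2).dim k.succ) j) hmem h0⟩
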